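/- **Setting.** Let $D\ge 1$ and let $f$ be a probability density on $\mathbb{R}^D$ with compact support which is upper semicontinuous (for instance, continuous on its support). Call $x$ a *mode* of $f$ if $f(x')\le f(x)$ for all $x'\in\mathbb{R}^D$; assume that $f$ is *unimodal*, i.e. has exactly one mode. A *local maximum* of $f$ is a nonempty connected set $M$ such that $f$ equals a constant $c$ on $M$ and, for some $r>0$, $f<c$ at all points outside $M$ at distance less than $r$ from $M$. Assume that every local maximum of $f$ is a single point, that there are finitely many of them, and that they have pairwise disjoint open neighbourhoods on which $f$ is twice differentiable, with negative definite Hessian at each of these points. **Algorithm.** For a finite data set $X$ (a multiset of points of $\mathbb{R}^D$) and $k\in\mathbb{N}$ let $r_k(x)=\inf\{r : |B(x,r)\cap X|\ge k\}$, where $B(x,r)$ is the closed Euclidean ball. The algorithm $\mathcal{A}_{k,\sigma}$ computes $\widehat{x}\in\operatorname{argmin}_{x\in X} r_k(x)$, with any fixed deterministic rule for breaking ties, and returns $\widehat{x}+Z$ with $Z\sim N(0,\sigma^2 I)$. **Privacy.** Two data sets are adjacent if one is obtained from the other by inserting, deleting or replacing at most one point. A randomized algorithm $\mathcal{A}$ is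 $(\epsilon,\delta)$-differentially private at the data set $X$ if for every $X'$ adjacent to $X$ and every measurable $S\subseteq\mathbb{R}^D$, $$\mathbb{P}(\mathcal{A}(X)\in S)\le e^{\epsilon}\,\mathbb{P}(\mathcal{A}(X')\in S)+\delta \quad\text{and}\quad \mathbb{P}(\mathcal{A}(X')\in S)\le e^{\epsilon}\,\mathbb{P}(\mathcal{A}(X)\in S)+\delta .$$ **Theorem.** There exist constants $C,C_1,C_2>0$ and $N\in\mathbb{N}$, depending only on $f$ (and $D$), such that the following holds for all $n\ge N$. Let $0<\delta<1$, $0<\epsilon\le 1$, and suppose that $\sigma\in\mathbb{R}$ and $k\in\mathbb{N}$ satisfy $$\sigma \ge C\,\log(2/\delta)\,(\log n)^{1/4}\,k^{-1/4}\,\epsilon^{-1},$$ $$C_1\,\log(1/\delta)^2\log n+1\;\le\; k\;\le\; C_2\,\log(1/\delta)^{2D/(4+D)}\,(\log n)^{D/(4+D)}\,n^{4/(4+D)} .$$ Then, with probability at least $1-\delta$ over $n$ i.i.d. samples $X=\{X_1,\dots,X_n\}$ drawn from $f$, the algorithm $\mathcal{A}_{k,\sigma}$ is $(\epsilon,\delta)$-differentially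 private at $X$. -/

import Mathlib

open MeasureTheory ProbabilityTheory
open scoped ENNReal

/-- `f` is a probability density on `ℝ^D`. -/
structure IsDensity {D : ℕ} (f : EuclideanSpace ℝ (Fin D) → ℝ) : Prop where
  measurable : Measurable f
  nonneg : ∀ x, 0 ≤ f x
  lintegral_eq_one : ∫⁻ x, ENNReal.ofReal (f x) = 1

/-- The probability distribution on `ℝ^D` with density `f`. -/
noncomputable def densityMeasure {D : ℕ} (f : EuclideanSpace ℝ (Fin D) → ℝ) :
    Measure (EuclideanSpace ℝ (Fin D)) :=
  volume.withDensity (fun x => ENNReal.ofReal (f x))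

/-- The law of `n` i.i.d. samples drawn from the density `f`. -/
noncomputable def sampleMeasure {D : ℕ} (f : EuclideanSpace ℝ (Fin D) → ℝ) (n : ℕ) :
    Measure (Fin n → EuclideanSpace ℝ (Fin D)) :=
  Measure.pi (fun _ => densityMeasure f)

/-- `x` is a mode (global maximiser) of `f`. -/
def IsMode {D : ℕ} (f : EuclideanSpace ℝ (Fin D) → ℝ) (x : EuclideanSpace ℝ (Fin D)) : Prop :=
  ∀ x', f x' ≤ f x

/-- `f` is unimodal: it has exactly one mode. -/
def IsUnimodal {D : ℕ} (f : EuclideanSpace ℝ (Fin D) → ℝ) : Prop :=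
  ∃! x, IsMode f x

/-- A local maximum of `f`: a (nonempty) connected region `M` on which `f` is constant, such that
`f` is smaller than this constant at all points outside `M` in some `r`-neighbourhood of `M`. -/
def IsLocalMaxRegion {D : ℕ} (f : EuclideanSpace ℝ (Fin D) → ℝ)
    (M : Set (EuclideanSpace ℝ (Fin D))) : Prop :=
  IsConnected M ∧ ∃ c : ℝ, (∀ x ∈ M, f x = c) ∧
    ∃ r : ℝ, 0 < r ∧ ∀ x ∈ Metric.thickening r M \ M, f x < c

/-- The set of those points which are local maxima of `f`. -/
def localModes {D : ℕ} (f : EuclideanSpace ℝ (Fin D) → ℝ) : Set (EuclideanSpace ℝ (Fin D)) :=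
  {x | IsLocalMaxRegion f {x}}

/-- The modal structure assumption: each local maximum of `f` is a point, there are finitely many
of them, and they have pairwise disjoint neighbourhoods in which `f` is twice differentiable, with
negative definite Hessian at each of these points. -/
structure ModalStructure {D : ℕ} (f : EuclideanSpace ℝ (Fin D) → ℝ) : Prop where
  isPoint : ∀ M, IsLocalMaxRegion f M → ∃ x, M = {x}
  finite : (localModes f).Finite
  nhds : ∃ U : EuclideanSpace ℝ (Fin D) → Set (EuclideanSpace ℝ (Fin D)),
    (localModes f).PairwiseDisjoint U ∧
    ∀ x ∈ localModes f, IsOpen (U x) ∧ x ∈ U x ∧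
      DifferentiableOn ℝ f (U x) ∧ DifferentiableOn ℝ (fderiv ℝ f) (U x) ∧
      ∀ v, v ≠ 0 → fderiv ℝ (fderiv ℝ f) x v v < 0

open Classical in
/-- The `k`-nearest-neighbour radius `r_k(x) = inf {r : |B(x, r) ∩ X| ≥ k}` of `x` with respect to
the data set `X` (a finite multiset of points, closed balls); it is `∞` if `X` has fewer than `k`
points. -/
noncomputable def knnRadius {D : ℕ} (k : ℕ) (X : Multiset (EuclideanSpace ℝ (Fin D)))
    (x : EuclideanSpace ℝ (Fin D)) : ℝ≥0∞ :=
  sInf {r : ℝ≥0∞ | k ≤ (X.filter (fun y => edist y x ≤ r)).card}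

/-- `est` computes the `k`-NN mode estimate `argmin_{x ∈ X} r_k(x)` of every nonempty data set `X`
(with an arbitrary way of breaking ties). -/
def IsKnnModeEstimator {D : ℕ} (k : ℕ)
    (est : Multiset (EuclideanSpace ℝ (Fin D)) → EuclideanSpace ℝ (Fin D)) : Prop :=
  ∀ X, X ≠ 0 → est X ∈ X ∧ ∀ y ∈ X, knnRadius k X (est X) ≤ knnRadius k X y

/-- The law of the output `est X + N(0, σ² I)` of the private mode estimator on the data set `X`. -/
noncomputable def privateMode {D : ℕ}
    (est : Multiset (EuclideanSpace ℝ (Fin D)) → EuclideanSpace ℝ (Fin D)) (σ : ℝ)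
    (X : Multiset (EuclideanSpace ℝ (Fin D))) : Measure (EuclideanSpace ℝ (Fin D)) :=
  (stdGaussian (EuclideanSpace ℝ (Fin D))).map (fun z => est X + σ • z)

open Classical in
/-- Two data sets are adjacent if they differ by at most one data point: one of them arises from
the other by inserting, deleting or replacing at most one point. -/
def Adjacent {α : Type*} (d d' : Multiset α) : Prop :=
  (d - d').card ≤ 1 ∧ (d' - d).card ≤ 1

/-- The randomized mechanism `M` (mapping a data set to the law of its output) is
`(ε, δ)`-differentially private at the data set `d`: the defining inequality holds for `d` and each
data set `d'` adjacent to it, in both directions. -/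
def IsDifferentiallyPrivateAt {α β : Type*} [MeasurableSpace β] (M : Multiset α → Measure β)
    (ε δ : ℝ) (d : Multiset α) : Prop :=
  ∀ d', Adjacent d d' → ∀ S : Set β, MeasurableSet S →
    M d S ≤ ENNReal.ofReal (Real.exp ε) * M d' S + ENNReal.ofReal δ ∧
    M d' S ≤ ENNReal.ofReal (Real.exp ε) * M d S + ENNReal.ofReal δ

/-!
The estimate is stable because the sample localises it. Write `x₀` for the mode, `L = log (2 / δ)`
and `τ = 24 * D * L * √(log n / k)`, the relative precision with which a sample determines the
masses of balls containing about `k` points, uniformly over the centres. The density has a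
quadratic peak at `x₀`: `f x₀ - c₁ ‖x - x₀‖² ≤ f x ≤ f x₀ - c₂ min (‖x - x₀‖²) 1`
(`exists_global_quadratic_bounds`; the upper bound near `x₀` comes from the Hessian, and far from
`x₀` from semicontinuity, compactness and uniqueness of the mode). Choose `r` so that a ball of
radius `r` at the maximal density has expected count `k (1 + 4 τ)`. The upper bound on `k` says
that `r² ≲ τ`, so that balls of radius `r` centred near the mode keep an expected count above
`k (1 + 2 τ)`, while the quadratic decay pushes the expected count below `k (1 - 5 τ)` once the
centre is at distance `R ~ √τ` or more. A Chernoff bound and a union bound over a grid of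
polynomial size turn this into a statement about all centres simultaneously, with probability
`1 - δ` (`IsDensity.exists_separating_event`). Only the one radius `r` matters, so no uniform
(Vapnik–Chervonenkis) theory is needed.

On this event at least two data points near the mode have more than `k` neighbours within distance
`r`, and all points outside `B(x₀, R)` have fewer than `k - 1`. Changing one data point moves each
count by at most one, so the estimate stays in `B(x₀, R)` (`IsKnnModeEstimator.mem_closedBall`).
Hence its sensitivity is at most `2 R ~ L ^ (1/2) (log n / k) ^ (1/4)`, and the Gaussian mechanism
(`stdGaussian_map_add_smul_le`, from the Cameron–Martin formula) needs noise of order `R √L / ε`,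
which is what is assumed of `σ`.

If `τ` is not small, the assumed noise is at least of order `√L / ε`, and the trivial
localisation of the estimate in a fixed ball around the support suffices
(`IsDensity.exists_bounding_event`); here the two bounds on `k` enter only through `2 ≤ k` and
`2 k ≤ n`.
-/

/-! ### The Gaussian mechanism -/

theorem gaussianReal_withDensity_exp (b : ℝ) :
    (gaussianReal 0 1).withDensity (fun x => ENNReal.ofReal (Real.exp (b * x - b ^ 2 / 2))) =
      gaussianReal b 1 := by
  rw [gaussianReal_of_var_ne_zero _ one_ne_zero, gaussianReal_of_var_ne_zero _ one_ne_zero,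
    ← withDensity_mul _ (measurable_gaussianPDF _ _) (by fun_prop)]
  congr 1
  ext x
  rw [Pi.mul_apply, gaussianPDF, gaussianPDF, ← ENNReal.ofReal_mul (gaussianPDFReal_nonneg _ _ _),
    gaussianPDFReal, gaussianPDFReal, mul_assoc, ← Real.exp_add]
  congr 3
  simp only [NNReal.coe_one]
  ring

theorem pi_gaussianReal_withDensity_exp {ι : Type*} [Fintype ι] (b : ι → ℝ) :
    (Measure.pi fun _ : ι => gaussianReal 0 1).withDensity
        (fun x => ENNReal.ofReal (∏ i, Real.exp (b i * x i - b i ^ 2 / 2))) =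
      Measure.pi fun i => gaussianReal (b i) 1 := by
  have hint : ∀ c : ℝ, Integrable (fun x : ℝ => Real.exp (c * x - c ^ 2 / 2))
      (gaussianReal 0 1) := by
    intro c
    simp_rw [sub_eq_add_neg, Real.exp_add]
    exact (integrable_exp_mul_gaussianReal c).mul_const _
  refine (Measure.pi_eq fun s hs => ?_).symm
  rw [withDensity_apply _ (MeasurableSet.univ_pi hs), Measure.restrict_pi_pi,
    ← ofReal_integral_eq_lintegral_ofReal, 
    integral_fintype_prod_eq_prod (fun i x => Real.exp (b i * x - b i ^ 2 / 2)),
    ENNReal.ofReal_prod_of_nonneg fun i _ => by positivity]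
  · refine Finset.prod_congr rfl fun i _ => ?_
    rw [← gaussianReal_withDensity_exp (b i), withDensity_apply _ (hs i),
      ofReal_integral_eq_lintegral_ofReal (hint _).integrableOn
        (ae_of_all _ fun _ => by positivity)]
  · exact Integrable.fintype_prod_dep fun i => (hint (b i)).integrableOn
  · exact ae_of_all _ fun _ => by positivity

theorem pi_gaussianReal_map_add {ι : Type*} [Fintype ι] (b : ι → ℝ) :
    (Measure.pi fun _ : ι => gaussianReal 0 1).map (fun x => b + x) =
      Measure.pi fun i => gaussianReal (b i) 1 := by
  have h := Measure.pi_map_pi (μ := fun _ : ι => gaussianReal 0 1) (f := fun i x => b i + x)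
    (hμ := fun i => by rw [gaussianReal_map_const_add]; infer_instance)
    (fun i => by fun_prop)
  simp_rw [gaussianReal_map_const_add, zero_add] at h
  exact h

/-- Cameron–Martin formula: the standard Gaussian measure translated by `b` has density
`exp (⟪b, z⟫ - ‖b‖² / 2)` with respect to the standard Gaussian measure. -/
theorem stdGaussian_map_add {D : ℕ} (b : EuclideanSpace ℝ (Fin D)) :
    (stdGaussian (EuclideanSpace ℝ (Fin D))).map (fun z => b + z) =
      (stdGaussian (EuclideanSpace ℝ (Fin D))).withDensity
        (fun z => ENNReal.ofReal (Real.exp (inner ℝ b z - ‖b‖ ^ 2 / 2))) := by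
  have hpi := (pi_gaussianReal_map_add (fun i => b i)).trans
    (pi_gaussianReal_withDensity_exp (fun i => b i)).symm
  have hm : Measurable (WithLp.toLp 2 : (Fin D → ℝ) → EuclideanSpace ℝ (Fin D)) := by fun_prop
  ext S hS
  rw [Measure.map_apply (by fun_prop) hS, withDensity_apply _ hS, ← map_pi_eq_stdGaussian,
    Measure.map_apply hm (hS.preimage (by fun_prop)), setLIntegral_map hS (by fun_prop) hm]
  have h2 := congrArg (fun ν => ν (WithLp.toLp 2 ⁻¹' S)) hpi
  simp only at h2
  rw [Measure.map_apply (by fun_prop) (hm hS), withDensity_apply _ (hm hS)] at h2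
  refine Eq.trans ?_ (h2.trans ?_)
  · rfl
  · refine lintegral_congr fun x => ?_
    congr 1
    rw [← Real.exp_sum, EuclideanSpace.real_norm_sq_eq, PiLp.inner_apply, Finset.sum_sub_distrib,
      Finset.sum_div]
    simp [mul_comm]

/-- The moment generating function of the standard Gaussian measure. -/
theorem lintegral_exp_inner_stdGaussian {D : ℕ} (b : EuclideanSpace ℝ (Fin D)) :
    ∫⁻ z, ENNReal.ofReal (Real.exp (inner ℝ b z)) ∂stdGaussian (EuclideanSpace ℝ (Fin D)) =
      ENNReal.ofReal (Real.exp (‖b‖ ^ 2 / 2)) := by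
  have h := congrArg (fun ν => ν Set.univ) (stdGaussian_map_add b)
  simp only at h
  rw [Measure.map_apply (by fun_prop) MeasurableSet.univ, withDensity_apply _ MeasurableSet.univ,
    Measure.restrict_univ, Set.preimage_univ, measure_univ] at h
  have h3 : ∀ z, ENNReal.ofReal (Real.exp (inner ℝ b z)) = ENNReal.ofReal (Real.exp (‖b‖ ^ 2 / 2)) *
      ENNReal.ofReal (Real.exp (inner ℝ b z - ‖b‖ ^ 2 / 2)) := by
    intro z
    rw [← ENNReal.ofReal_mul (by positivity), ← Real.exp_add]
    congr 2
    ring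
  simp_rw [h3]
  rw [lintegral_const_mul _ (by fun_prop), ← h, mul_one]

/-- Chernoff bound for a linear functional of a standard Gaussian vector. -/
theorem stdGaussian_inner_ge_le {D : ℕ} (b : EuclideanSpace ℝ (Fin D)) (s t : ℝ) (hs : 0 ≤ s) :
    stdGaussian (EuclideanSpace ℝ (Fin D)) {z | t ≤ inner ℝ b z} ≤
      ENNReal.ofReal (Real.exp (s ^ 2 * ‖b‖ ^ 2 / 2 - s * t)) := by
  have h := meas_ge_le_lintegral_div (μ := stdGaussian (EuclideanSpace ℝ (Fin D)))
    (f := fun z => ENNReal.ofReal (Real.exp (inner ℝ (s • b) z)))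
    (by fun_prop) (ε := ENNReal.ofReal (Real.exp (s * t))) (by simp [Real.exp_pos])
    ENNReal.ofReal_ne_top
  rw [lintegral_exp_inner_stdGaussian, ← ENNReal.ofReal_div_of_pos (Real.exp_pos _),
    ← Real.exp_sub, norm_smul, mul_pow, Real.norm_eq_abs, sq_abs] at h
  refine (measure_mono fun z hz => ?_).trans h
  simp only [Set.mem_ofPred_eq] at hz ⊢
  refine ENNReal.ofReal_le_ofReal (Real.exp_le_exp.2 ?_)
  rw [real_inner_smul_left]
  exact mul_le_mul_of_nonneg_left hz hs

/-- Gaussian mechanism for unit variance: a shift by `b` with `9 ‖b‖² log (2/δ) ≤ ε²` changes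
probabilities by at most a factor `e^ε` and an additive error `δ`. The additive error is the mass of
the half-space on which the density of the shifted measure exceeds `e^ε`. -/
theorem stdGaussian_map_add_le {D : ℕ} (b : EuclideanSpace ℝ (Fin D)) {ε δ : ℝ} (hδ : 0 < δ)
    (hδ1 : δ < 1) (hε : 0 < ε) (hε1 : ε ≤ 1) (hb : 9 * ‖b‖ ^ 2 * Real.log (2 / δ) ≤ ε ^ 2)
    {S : Set (EuclideanSpace ℝ (Fin D))} (hS : MeasurableSet S) :
    (stdGaussian (EuclideanSpace ℝ (Fin D))).map (fun z => b + z) S ≤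
      ENNReal.ofReal (Real.exp ε) * stdGaussian (EuclideanSpace ℝ (Fin D)) S +
        ENNReal.ofReal δ := by
  set γ := stdGaussian (EuclideanSpace ℝ (Fin D)) with hγ
  set L := Real.log (2 / δ) with hL
  have hL2 : 1 / 2 ≤ L := by
    have h2 : Real.log 2 ≤ L := Real.log_le_log (by norm_num) (by
      rw [le_div_iff₀ hδ]; linarith)
    linarith [Real.log_two_gt_d9]
  set T : Set (EuclideanSpace ℝ (Fin D)) := {z | ε ≤ inner ℝ b z - ‖b‖ ^ 2 / 2} with hT
  have hTm : MeasurableSet T := measurableSet_le (by fun_prop) (by fun_prop)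
  have hb0 : 0 ≤ ‖b‖ ^ 2 := by positivity
  have hbε : ‖b‖ ^ 2 ≤ ε := by nlinarith
  have h1 : γ.map (fun z => b + z) (S \ T) ≤ ENNReal.ofReal (Real.exp ε) * γ S := by
    rw [stdGaussian_map_add, withDensity_apply _ (hS.diff hTm)]
    calc _ ≤ ∫⁻ _ in S \ T, ENNReal.ofReal (Real.exp ε) ∂γ := by
          refine setLIntegral_mono measurable_const fun z hz => ?_
          refine ENNReal.ofReal_le_ofReal (Real.exp_le_exp.2 ?_)
          have := hz.2
          simp only [hT, Set.mem_ofPred_eq, not_le] at this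
          exact this.le
      _ = ENNReal.ofReal (Real.exp ε) * γ (S \ T) := by rw [setLIntegral_const]
      _ ≤ _ := by gcongr; exact Set.sdiff_subset
  have h2 : γ.map (fun z => b + z) T ≤ ENNReal.ofReal δ := by
    rw [Measure.map_apply (by fun_prop) hTm]
    -- after the shift, `T` is the half-space `ε - ‖b‖ ^ 2 / 2 ≤ ⟪b, z⟫`, and `‖b‖ ^ 2 ≤ ε`;
    -- the Chernoff parameter is of the optimal order `ε / ‖b‖ ^ 2` for the largest allowed `‖b‖`
    refine (measure_mono (t := {z | ε / 2 ≤ inner ℝ b z}) fun z hz => ?_).trans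
      ((stdGaussian_inner_ge_le b (4 * L / ε) (ε / 2) (by positivity)).trans ?_)
    · simp only [hT, Set.mem_preimage, Set.mem_ofPred_eq, inner_add_right,
        real_inner_self_eq_norm_sq] at hz ⊢
      linarith
    · refine ENNReal.ofReal_le_ofReal ?_
      have hLe : Real.exp (-L) = δ / 2 := by
        rw [hL, Real.exp_neg, Real.exp_log (by positivity), inv_div]
      have h3 : (4 * L / ε) ^ 2 * ‖b‖ ^ 2 / 2 - 4 * L / ε * (ε / 2) ≤ -L := by
        have h4 : (4 * L / ε) ^ 2 * ‖b‖ ^ 2 / 2 = (8 / 9) * L * (9 * ‖b‖ ^ 2 * L / ε ^ 2) := by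
          field_simp
          ring
        have h5 : 9 * ‖b‖ ^ 2 * L / ε ^ 2 ≤ 1 := by
          rw [div_le_one (by positivity)]; exact hb
        have h6 : 4 * L / ε * (ε / 2) = 2 * L := by
          field_simp
          norm_num
        rw [h4, h6]
        nlinarith
      calc _ ≤ Real.exp (-L) := Real.exp_le_exp.2 h3
        _ ≤ δ := by rw [hLe]; linarith
  calc _ ≤ γ.map (fun z => b + z) (S \ T ∪ T) := measure_mono (by simp)
    _ ≤ _ := (measure_union_le _ _).trans (add_le_add h1 h2)

/-- Gaussian mechanism: isotropic Gaussian noise of standard deviation at least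
`3 ‖a - a'‖ √(log (2/δ)) / ε` makes the released values `a` and `a'` indistinguishable
up to `(ε, δ)`. -/
theorem stdGaussian_map_add_smul_le {D : ℕ} (a a' : EuclideanSpace ℝ (Fin D)) {ε δ σ : ℝ}
    (hδ : 0 < δ) (hδ1 : δ < 1) (hε : 0 < ε) (hε1 : ε ≤ 1) (hσ : 0 < σ)
    (hb : 9 * ‖a - a'‖ ^ 2 * Real.log (2 / δ) ≤ (σ * ε) ^ 2)
    {S : Set (EuclideanSpace ℝ (Fin D))} (hS : MeasurableSet S) :
    (stdGaussian (EuclideanSpace ℝ (Fin D))).map (fun z => a + σ • z) S ≤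
      ENNReal.ofReal (Real.exp ε) *
        (stdGaussian (EuclideanSpace ℝ (Fin D))).map (fun z => a' + σ • z) S +
        ENNReal.ofReal δ := by
  have hm : Measurable (fun z : EuclideanSpace ℝ (Fin D) => a' + σ • z) := by fun_prop
  have h := stdGaussian_map_add_le (σ⁻¹ • (a - a')) hδ hδ1 hε hε1 (by
    rw [norm_smul, mul_pow, Real.norm_eq_abs, sq_abs, inv_pow]
    rw [mul_pow] at hb
    have : 9 * ((σ ^ 2)⁻¹ * ‖a - a'‖ ^ 2) * Real.log (2 / δ) =
      9 * ‖a - a'‖ ^ 2 * Real.log (2 / δ) / σ ^ 2 := by ring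
    rw [this, div_le_iff₀ (by positivity)]
    linarith) (hm hS)
  rw [Measure.map_apply hm hS]
  refine le_trans (le_of_eq ?_) h
  rw [Measure.map_apply (by fun_prop) hS, Measure.map_apply (by fun_prop) (hm hS)]
  congr 1
  ext z
  simp only [Set.mem_preimage, smul_add, smul_inv_smul₀ hσ.ne']
  rw [← add_assoc, add_sub_cancel]

/-! ### Concentration of the number of sample points in a set -/

open Classical in
/-- The number of points of the sample `x` that lie in `A`. -/
noncomputable def hits {Ω : Type*} {n : ℕ} (A : Set Ω) (x : Fin n → Ω) : ℕ :=
  (Finset.univ.filter fun i => x i ∈ A).card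

theorem hits_mono {Ω : Type*} {n : ℕ} {A B : Set Ω} (h : A ⊆ B) (x : Fin n → Ω) :
    hits A x ≤ hits B x := by
  classical
  exact Finset.card_le_card (Finset.monotone_filter_right _ fun i _ hi => h hi)

theorem cast_hits {Ω : Type*} {n : ℕ} (A : Set Ω) (x : Fin n → Ω) :
    (hits A x : ℝ) = ∑ i, A.indicator (fun _ => (1 : ℝ)) (x i) := by
  classical
  simp [hits, Set.indicator_apply, Finset.sum_boole]

theorem measurable_hits {Ω : Type*} [MeasurableSpace Ω] {n : ℕ} {A : Set Ω}
    (hA : MeasurableSet A) : Measurable fun x : Fin n → Ω => (hits A x : ℝ) := by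
  simp_rw [cast_hits]
  exact Finset.measurable_sum _ fun i _ =>
    (measurable_const.indicator hA).comp (measurable_pi_apply i)

theorem exp_indicator_eq {Ω : Type*} (A : Set Ω) (l : ℝ) (y : Ω) :
    Real.exp (l * A.indicator (fun _ => (1 : ℝ)) y) =
      1 + A.indicator (fun _ => Real.exp l - 1) y := by
  by_cases hy : y ∈ A <;> simp [hy]

theorem exp_mul_hits {Ω : Type*} {n : ℕ} (A : Set Ω) (l : ℝ) (x : Fin n → Ω) :
    Real.exp (l * hits A x) = ∏ i, (1 + A.indicator (fun _ => Real.exp l - 1) (x i)) := by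
  simp_rw [cast_hits, Finset.mul_sum, Real.exp_sum, exp_indicator_eq]

section
variable {Ω : Type*} [MeasurableSpace Ω] (μ : Measure Ω) [IsProbabilityMeasure μ] (n : ℕ)

theorem integrable_exp_mul_hits {A : Set Ω} (hA : MeasurableSet A) (l : ℝ) :
    Integrable (fun x : Fin n → Ω => Real.exp (l * hits A x)) (Measure.pi fun _ => μ) := by
  simp_rw [exp_mul_hits]
  exact Integrable.fintype_prod (f := fun _ y => 1 + A.indicator (fun _ => Real.exp l - 1) y)
    fun _ => (integrable_const _).add ((integrable_const _).indicator hA)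

theorem mgf_hits_le {A : Set Ω} (hA : MeasurableSet A) (l : ℝ) :
    mgf (fun x : Fin n → Ω => (hits A x : ℝ)) (Measure.pi fun _ => μ) l ≤
      Real.exp (n * μ.real A * (Real.exp l - 1)) := by
  rw [mgf]
  simp_rw [exp_mul_hits]
  rw [integral_fintype_prod_eq_pow (fun y => 1 + A.indicator (fun _ => Real.exp l - 1) y),
    integral_add (integrable_const _) ((integrable_const _).indicator hA),
    integral_indicator_const _ hA]
  simp only [integral_const, probReal_univ, smul_eq_mul, mul_one, Fintype.card_fin]
  have h0 : 0 ≤ 1 + μ.real A * (Real.exp l - 1) := by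
    have h1 : μ.real A ≤ 1 := measureReal_le_one
    have h2 : 0 ≤ μ.real A := measureReal_nonneg
    nlinarith [Real.exp_pos l]
  rw [mul_assoc, Real.exp_nat_mul]
  refine pow_le_pow_left₀ h0 ?_ n
  linarith [Real.add_one_le_exp (μ.real A * (Real.exp l - 1))]

/-- Chernoff bound for the upper tail of a binomial variable of mean at most `a`. -/
theorem measureReal_hits_ge_le {A : Set Ω} (hA : MeasurableSet A) {a m t : ℝ}
    (ha : n * μ.real A ≤ a) (ham : a ≤ m) (hm : 0 < m)
    (ht : 0 ≤ t) (htm : t ≤ 2 * m) :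
    (Measure.pi fun _ : Fin n => μ).real {x | a + t ≤ hits A x} ≤
      Real.exp (-(t ^ 2 / (4 * m))) := by
  -- this value of `l` minimises the exponent `m * l ^ 2 - l * t`
  set l := t / (2 * m) with hl
  have hl0 : 0 ≤ l := by positivity
  have hl1 : l ≤ 1 := (div_le_one (by positivity)).2 htm
  refine (measure_ge_le_exp_mul_mgf (a + t) hl0 (integrable_exp_mul_hits μ n hA l)).trans ?_
  refine (mul_le_mul_of_nonneg_left (mgf_hits_le μ n hA l) (Real.exp_pos _).le).trans ?_
  rw [← Real.exp_add, Real.exp_le_exp]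
  have h1 : Real.exp l - 1 ≤ l + l ^ 2 := by
    have := (abs_le.1 (Real.abs_exp_sub_one_sub_id_le (abs_le.2 ⟨by linarith, hl1⟩))).2
    linarith
  have h2 : 0 ≤ Real.exp l - 1 := by linarith [Real.add_one_le_exp l]
  have h4 : n * μ.real A * (Real.exp l - 1) ≤ a * l + m * l ^ 2 := by
    calc _ ≤ a * (Real.exp l - 1) := by gcongr
      _ ≤ a * (l + l ^ 2) := by
        gcongr
        exact le_trans (by positivity) ha
      _ ≤ _ := by nlinarith [sq_nonneg l]
  have h5 : m * l ^ 2 - l * t = -(t ^ 2 / (4 * m)) := by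
    rw [hl]
    field_simp
    ring
  linarith

/-- Chernoff bound for the lower tail of a binomial variable of mean at least `m`. -/
theorem measureReal_hits_le_le {A : Set Ω} (hA : MeasurableSet A) {m t : ℝ}
    (ha : m ≤ n * μ.real A) (hm : 0 < m)
    (ht : 0 ≤ t) (htm : t ≤ 2 * m) :
    (Measure.pi fun _ : Fin n => μ).real {x | hits A x ≤ m - t} ≤
      Real.exp (-(t ^ 2 / (4 * m))) := by
  set l := t / (2 * m) with hl
  have hl0 : 0 ≤ l := by positivity
  have hl1 : l ≤ 1 := (div_le_one (by positivity)).2 htm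
  refine (measure_le_le_exp_mul_mgf (m - t) (neg_nonpos.2 hl0)
    (integrable_exp_mul_hits μ n hA (-l))).trans ?_
  refine (mul_le_mul_of_nonneg_left (mgf_hits_le μ n hA (-l)) (Real.exp_pos _).le).trans ?_
  rw [← Real.exp_add, Real.exp_le_exp]
  have h1 : Real.exp (-l) - 1 ≤ -l + l ^ 2 := by
    have := (abs_le.1 (Real.abs_exp_sub_one_sub_id_le (x := -l)
      (abs_le.2 ⟨by linarith, by linarith⟩))).2
    linarith
  have h2 : Real.exp (-l) - 1 ≤ 0 := by linarith [Real.exp_le_one_iff.2 (neg_nonpos.2 hl0)]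
  have h4 : n * μ.real A * (Real.exp (-l) - 1) ≤ - m * l + m * l ^ 2 := by
    calc _ ≤ m * (Real.exp (-l) - 1) := mul_le_mul_of_nonpos_right ha h2
      _ ≤ m * (-l + l ^ 2) := by gcongr
      _ = _ := by ring
  have h5 : m * l ^ 2 - l * t = -(t ^ 2 / (4 * m)) := by
    rw [hl]
    field_simp
    ring
  linarith
end

/-! ### Stability of the nearest-neighbour mode estimate -/

open Classical in
/-- The number of points of the data set `X`, with multiplicity, in the closed ball `B(x, r)`. -/
noncomputable def ballCount {D : ℕ} (X : Multiset (EuclideanSpace ℝ (Fin D)))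
    (x : EuclideanSpace ℝ (Fin D)) (r : ℝ) : ℕ :=
  X.countP fun y => y ∈ Metric.closedBall x r

theorem knnRadius_le {D k : ℕ} {X : Multiset (EuclideanSpace ℝ (Fin D))}
    {x : EuclideanSpace ℝ (Fin D)} {r : ℝ} (hr : 0 ≤ r) (h : k ≤ ballCount X x r) :
    knnRadius k X x ≤ ENNReal.ofReal r := by
  classical
  refine sInf_le ?_
  rw [ballCount, Multiset.countP_eq_card_filter] at h
  simpa only [Set.mem_ofPred_eq, edist_le_ofReal hr, Metric.mem_closedBall] using h

theorem le_ballCount_of_knnRadius_le {D k : ℕ} {X : Multiset (EuclideanSpace ℝ (Fin D))}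
    {x : EuclideanSpace ℝ (Fin D)} {r r' : ℝ} (hr : 0 ≤ r) (hrr' : r < r')
    (h : knnRadius k X x ≤ ENNReal.ofReal r) : k ≤ ballCount X x r' := by
  classical
  have hr' : 0 < r' := hr.trans_lt hrr'
  obtain ⟨s, hs, hsr⟩ := sInf_lt_iff.1
    (h.trans_lt ((ENNReal.ofReal_lt_ofReal_iff hr').2 hrr'))
  rw [ballCount, Multiset.countP_eq_card_filter]
  refine le_trans hs (Multiset.card_le_card (Multiset.monotone_filter_right _ fun y hy => ?_))
  rw [Metric.mem_closedBall, ← edist_le_ofReal hr'.le]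
  exact le_trans hy hsr.le

open Classical in
theorem Adjacent.countP_le {α : Type*} {d d' : Multiset α} (h : Adjacent d d') (p : α → Prop) :
    d.countP p ≤ d'.countP p + 1 := by
  have h1 : d ≤ d' + (d - d') := le_add_tsub
  have h2 := Multiset.countP_le_of_le p h1
  rw [Multiset.countP_add] at h2
  have h3 := Multiset.countP_le_card p (d - d')
  have h4 := h.1
  omega

theorem Adjacent.symm {α : Type*} {d d' : Multiset α} (h : Adjacent d d') : Adjacent d' d :=
  ⟨h.2, h.1⟩

theorem Adjacent.refl {α : Type*} (d : Multiset α) : Adjacent d d := by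
  simp [Adjacent]

open Classical in
/-- Stability of the `k`-NN mode estimate. If `S` contains at least two data points and each point
of `S` has `k + 1` data points within distance `r`, while all points outside `B(c, R)` have fewer
than `k - 1` data points within distance `r' > r`, then changing one data point keeps the estimate
in `B(c, R)`: at least one data point of `S` survives. -/
theorem IsKnnModeEstimator.mem_closedBall {D k : ℕ}
    {est : Multiset (EuclideanSpace ℝ (Fin D)) → EuclideanSpace ℝ (Fin D)}
    (hest : IsKnnModeEstimator k est) {X Y : Multiset (EuclideanSpace ℝ (Fin D))}
    (hXY : Adjacent X Y) {c : EuclideanSpace ℝ (Fin D)} {r r' R : ℝ} (hr : 0 ≤ r) (hrr' : r < r')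
    {S : Set (EuclideanSpace ℝ (Fin D))} (hS : 2 ≤ X.countP fun p => p ∈ S)
    (hnear : ∀ p ∈ S, k + 1 ≤ ballCount X p r)
    (hfar : ∀ y, R < dist y c → ballCount X y r' + 1 < k) :
    est Y ∈ Metric.closedBall c R := by
  have h1 : 0 < Y.countP fun p => p ∈ S := by
    have := hXY.countP_le fun p => p ∈ S
    omega
  obtain ⟨p, hpY, hpS⟩ := Multiset.countP_pos.1 h1
  have hp := hnear p hpS
  have hpk : k ≤ ballCount Y p r := by
    have := hXY.countP_le fun y => y ∈ Metric.closedBall p r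
    simp only [ballCount] at hp ⊢
    omega
  have hY : Y ≠ 0 := by
    rintro rfl
    simp at hpY
  have hle := ((hest Y hY).2 p hpY).trans (knnRadius_le hr hpk)
  have hk := le_ballCount_of_knnRadius_le hr hrr' hle
  by_contra hout
  have h2 := hfar (est Y) (not_le.1 hout)
  have h3 := hXY.symm.countP_le fun y => y ∈ Metric.closedBall (est Y) r'
  simp only [ballCount] at h2 hk
  omega

theorem ballCount_sample {D n : ℕ} (x : Fin n → EuclideanSpace ℝ (Fin D))
    (y : EuclideanSpace ℝ (Fin D)) (r : ℝ) :
    ballCount (Finset.univ.val.map x) y r = hits (Metric.closedBall y r) x := by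
  classical
  rw [ballCount, Multiset.countP_map]
  rfl

/-- Deterministic criterion for privacy at a sample `x`: the sample localises the estimate in
`B(c, R)`, robustly under the change of one point, and the noise is calibrated to the diameter
`2 * R`. -/
theorem IsKnnModeEstimator.isDifferentiallyPrivateAt {D k n : ℕ}
    {est : Multiset (EuclideanSpace ℝ (Fin D)) → EuclideanSpace ℝ (Fin D)}
    (hest : IsKnnModeEstimator k est) {x : Fin n → EuclideanSpace ℝ (Fin D)}
    {c : EuclideanSpace ℝ (Fin D)} {r r' R ε δ σ : ℝ} (hr : 0 ≤ r) (hrr' : r < r')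
    {S : Set (EuclideanSpace ℝ (Fin D))} (hS : 2 ≤ hits S x)
    (hnear : ∀ p ∈ S, k + 1 ≤ hits (Metric.closedBall p r) x)
    (hfar : ∀ y, R < dist y c → hits (Metric.closedBall y r') x + 1 < k)
    (hδ : 0 < δ) (hδ1 : δ < 1) (hε : 0 < ε) (hε1 : ε ≤ 1) (hσ : 0 < σ)
    (hσR : 36 * R ^ 2 * Real.log (2 / δ) ≤ (σ * ε) ^ 2) :
    IsDifferentiallyPrivateAt (privateMode est σ) ε δ (Finset.univ.val.map x) := by
  classical
  set X := Finset.univ.val.map x with hX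
  have hS' : 2 ≤ X.countP fun p => p ∈ S := by
    rw [hX, Multiset.countP_map]
    exact hS
  have hnear' : ∀ p ∈ S, k + 1 ≤ ballCount X p r := by
    simpa only [hX, ballCount_sample] using hnear
  have hfar' : ∀ y, R < dist y c → ballCount X y r' + 1 < k := by
    simpa only [hX, ballCount_sample] using hfar
  have hmem : ∀ Y, Adjacent X Y → dist (est Y) c ≤ R := fun Y hY =>
    hest.mem_closedBall hY hr hrr' hS' hnear' hfar'
  have hlog : 0 ≤ Real.log (2 / δ) := Real.log_nonneg (by rw [le_div_iff₀ hδ]; linarith)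
  have hdist : ∀ Y Z, Adjacent X Y → Adjacent X Z →
      9 * ‖est Y - est Z‖ ^ 2 * Real.log (2 / δ) ≤ (σ * ε) ^ 2 := by
    intro Y Z hY hZ
    refine le_trans ?_ hσR
    have h1 : ‖est Y - est Z‖ ≤ 2 * R := by
      rw [← dist_eq_norm]
      linarith [dist_triangle_right (est Y) (est Z) c, hmem Y hY, hmem Z hZ]
    have h2 := pow_le_pow_left₀ (norm_nonneg _) h1 2
    exact mul_le_mul_of_nonneg_right (by linarith) hlog
  intro Y hY T hT
  exact ⟨stdGaussian_map_add_smul_le _ _ hδ hδ1 hε hε1 hσ (hdist X Y (.refl X) hY) hT,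
    stdGaussian_map_add_smul_le _ _ hδ hδ1 hε hε1 hσ (hdist Y X hY (.refl X)) hT⟩

/-! ### The density near its mode -/

theorem le_add_of_deriv_le_linear {φ φ' : ℝ → ℝ} {a : ℝ}
    (hφ : ∀ t ∈ Set.Icc (0 : ℝ) 1, HasDerivAt φ (φ' t) t)
    (hle : ∀ t ∈ Set.Icc (0 : ℝ) 1, φ' t ≤ 2 * a * t) : φ 1 ≤ φ 0 + a := by
  have hd : ∀ t ∈ Set.Icc (0 : ℝ) 1,
      HasDerivAt (fun t => φ t - a * t ^ 2) (φ' t - a * (2 * t)) t := by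
    intro t ht
    have h2 := ((hasDerivAt_pow 2 t).const_mul a)
    simp only [Nat.cast_ofNat, Nat.add_one_sub_one, pow_one] at h2
    exact (hφ t ht).sub h2
  have hanti : AntitoneOn (fun t => φ t - a * t ^ 2) (Set.Icc 0 1) := by
    refine antitoneOn_of_deriv_nonpos (convex_Icc 0 1)
      (fun t ht => (hd t ht).continuousAt.continuousWithinAt)
      (fun t ht => (hd t (interior_subset ht)).differentiableAt.differentiableWithinAt) ?_
    intro t ht
    rw [(hd t (interior_subset ht)).deriv]
    linarith [hle t (interior_subset ht)]
  have := hanti (Set.left_mem_Icc.2 zero_le_one) (Set.right_mem_Icc.2 zero_le_one) zero_le_one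
  simp only at this
  linarith

section
variable {E : Type*} [NormedAddCommGroup E] [NormedSpace ℝ E]

/-- A negative definite bilinear form on a finite-dimensional space is uniformly so. -/
theorem exists_forall_le_neg_mul_sq_norm [FiniteDimensional ℝ E] (H : E →L[ℝ] E →L[ℝ] ℝ)
    (hH : ∀ v, v ≠ 0 → H v v < 0) : ∃ m > 0, ∀ v, H v v ≤ -m * ‖v‖ ^ 2 := by
  have : ProperSpace E := FiniteDimensional.proper_real E
  obtain ⟨m, hm, hmle⟩ : ∃ m > 0, ∀ u ∈ Metric.sphere (0 : E) 1, H u u ≤ -m := by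
    rcases (Metric.sphere (0 : E) 1).eq_empty_or_nonempty with he | hne
    · exact ⟨1, one_pos, by simp [he]⟩
    · obtain ⟨u, hu, hmax⟩ := (isCompact_sphere (0 : E) 1).exists_isMaxOn hne
        (f := fun u => H u u) (by fun_prop)
      refine ⟨-(H u u), neg_pos.2 (hH u ?_), fun w hw => by simpa using hmax hw⟩
      rintro rfl
      simp at hu
  refine ⟨m, hm, fun v => ?_⟩
  rcases eq_or_ne v 0 with rfl | hv
  · simp
  · have hv' : ‖v‖ ≠ 0 := norm_ne_zero_iff.2 hv
    have h := hmle (‖v‖⁻¹ • v) (by simp [norm_smul, hv'])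
    simp only [map_smul, smul_apply, smul_eq_mul] at h
    have h2 : H v v = ‖v‖ ^ 2 * (‖v‖⁻¹ * (‖v‖⁻¹ * H v v)) := by field_simp
    rw [h2]
    nlinarith [sq_nonneg ‖v‖]

/-- Quadratic behaviour at a nondegenerate local maximum, by integrating the first-order expansion
of `fderiv ℝ f` along segments issued from the maximum. -/
theorem exists_quadratic_bounds_of_hessian_neg [FiniteDimensional ℝ E] {f : E → ℝ} {U : Set E}
    {x₀ : E} (hU : IsOpen U) (hx₀ : x₀ ∈ U) (hf : DifferentiableOn ℝ f U)
    (hf' : DifferentiableAt ℝ (fderiv ℝ f) x₀) (hcrit : fderiv ℝ f x₀ = 0)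
    (hH : ∀ v, v ≠ 0 → fderiv ℝ (fderiv ℝ f) x₀ v v < 0) :
    ∃ ρ > 0, ∃ c > 0, ∃ c' > 0, ∀ x, ‖x - x₀‖ < ρ →
      f x₀ - c' * ‖x - x₀‖ ^ 2 ≤ f x ∧ f x ≤ f x₀ - c * ‖x - x₀‖ ^ 2 := by
  set H := fderiv ℝ (fderiv ℝ f) x₀ with hHdef
  obtain ⟨m, hm, hmle⟩ := exists_forall_le_neg_mul_sq_norm H hH
  have ho := hf'.hasFDerivAt.isLittleO.def (half_pos hm)
  obtain ⟨ρ, hρ, hball⟩ := Metric.eventually_nhds_iff.1 (ho.and (hU.mem_nhds hx₀))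
  refine ⟨ρ, hρ, m / 4, by positivity, (‖H‖ + m / 2) / 2, by positivity, fun x hx => ?_⟩
  set h := x - x₀ with hh
  have hmem : ∀ t ∈ Set.Icc (0 : ℝ) 1, dist (x₀ + t • h) x₀ < ρ := by
    intro t ht
    rw [dist_eq_norm, add_sub_cancel_left, norm_smul, Real.norm_eq_abs, abs_of_nonneg ht.1]
    nlinarith [norm_nonneg h, ht.2]
  have hderiv : ∀ t ∈ Set.Icc (0 : ℝ) 1,
      HasDerivAt (fun t : ℝ => f (x₀ + t • h)) (fderiv ℝ f (x₀ + t • h) h) t := by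
    intro t ht
    have h1 : HasDerivAt (fun t : ℝ => x₀ + t • h) h t := by
      simpa using ((hasDerivAt_id t).smul_const h).const_add x₀
    exact ((hf.differentiableAt (hU.mem_nhds (hball (hmem t ht)).2)).hasFDerivAt).comp_hasDerivAt
      t h1
  have hclose : ∀ t ∈ Set.Icc (0 : ℝ) 1,
      |fderiv ℝ f (x₀ + t • h) h - t * H h h| ≤ m / 2 * t * ‖h‖ ^ 2 := by
    intro t ht
    have h1 := (hball (hmem t ht)).1
    rw [hcrit, sub_zero, add_sub_cancel_left, norm_smul, Real.norm_eq_abs,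
      abs_of_nonneg ht.1, map_smul] at h1
    have h2 := (fderiv ℝ f (x₀ + t • h) - t • H h).le_opNorm h
    simp only [sub_apply, smul_apply, smul_eq_mul,
      Real.norm_eq_abs] at h2
    refine h2.trans ((mul_le_mul_of_nonneg_right h1 (norm_nonneg h)).trans_eq ?_)
    ring
  have hx1 : x₀ + (1 : ℝ) • h = x := by simp [hh]
  have hx0 : x₀ + (0 : ℝ) • h = x₀ := by simp
  constructor
  · have := le_add_of_deriv_le_linear (a := (‖H‖ + m / 2) / 2 * ‖h‖ ^ 2)
      (fun t ht => (hderiv t ht).neg) (fun t ht => by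
        have h1 := (abs_le.1 (hclose t ht)).1
        have h2 : -(‖H‖ * ‖h‖ * ‖h‖) ≤ H h h := (abs_le.1 (H.le_opNorm₂ h h)).1
        have h3 := mul_le_mul_of_nonneg_left h2 ht.1
        nlinarith)
    simp only [Pi.neg_apply, hx1, hx0] at this
    linarith
  · have := le_add_of_deriv_le_linear (a := -(m / 4 * ‖h‖ ^ 2)) hderiv (fun t ht => by
        have h1 := (abs_le.1 (hclose t ht)).2
        have h3 := mul_le_mul_of_nonneg_left (hmle h) ht.1
        nlinarith)
    simp only [hx1, hx0] at this
    linarith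
end

theorem IsDensity.pos_of_isMode {D : ℕ} {f : EuclideanSpace ℝ (Fin D) → ℝ} (hf : IsDensity f)
    {x₀ : EuclideanSpace ℝ (Fin D)} (h₀ : IsMode f x₀) : 0 < f x₀ := by
  by_contra hle
  have h : ∀ x, ENNReal.ofReal (f x) = 0 := fun x =>
    ENNReal.ofReal_eq_zero.2 ((h₀ x).trans (not_lt.1 hle))
  have := hf.lintegral_eq_one
  simp [h] at this

/-- Away from its unique mode, a compactly supported upper semicontinuous density stays bounded away
from its maximum. -/
theorem exists_gap_of_isUnimodal {D : ℕ} {f : EuclideanSpace ℝ (Fin D) → ℝ}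
    (hsupp : HasCompactSupport f) (husc : UpperSemicontinuous f) (huni : IsUnimodal f)
    {x₀ : EuclideanSpace ℝ (Fin D)} (h₀ : IsMode f x₀) (hpos : 0 < f x₀) {ρ : ℝ} (hρ : 0 < ρ) :
    ∃ m > 0, ∀ x, ρ ≤ ‖x - x₀‖ → f x ≤ f x₀ - m := by
  set K := tsupport f ∩ {x | ρ ≤ ‖x - x₀‖} with hK
  have hKc : IsCompact K := hsupp.inter_right (isClosed_le (by fun_prop) (by fun_prop))
  obtain ⟨M, hM, hMle⟩ : ∃ M < f x₀, ∀ x ∈ K, f x ≤ M := by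
    rcases K.eq_empty_or_nonempty with he | hne
    · exact ⟨0, hpos, by simp [he]⟩
    · obtain ⟨y, hy, hmax⟩ := (husc.upperSemicontinuousOn K).exists_isMaxOn hne hKc
      refine ⟨f y, lt_of_le_of_ne (h₀ y) fun heq => ?_, fun x hx => hmax hx⟩
      have hyx : y = x₀ := huni.unique (fun x' => heq ▸ h₀ x') h₀
      have := hy.2
      simp only [hyx, sub_self, norm_zero, Set.mem_ofPred_eq] at this
      linarith
  refine ⟨min (f x₀ - M) (f x₀), lt_min (sub_pos.2 hM) hpos, fun x hx => ?_⟩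
  by_cases hxs : x ∈ tsupport f
  · have := hMle x ⟨hxs, hx⟩
    linarith [min_le_left (f x₀ - M) (f x₀)]
  · rw [image_eq_zero_of_notMem_tsupport hxs]
    linarith [min_le_right (f x₀ - M) (f x₀)]

/-- Global quadratic bounds on the density around its mode. -/
theorem exists_global_quadratic_bounds {D : ℕ} {f : EuclideanSpace ℝ (Fin D) → ℝ}
    (hf : IsDensity f) (hsupp : HasCompactSupport f) (husc : UpperSemicontinuous f)
    (huni : IsUnimodal f) (hmodal : ModalStructure f) :
    ∃ x₀, 0 < f x₀ ∧ ∃ c₁ > 0, ∃ c₂ > 0, ∀ x, f x₀ - c₁ * ‖x - x₀‖ ^ 2 ≤ f x ∧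
      f x ≤ f x₀ - c₂ * min (‖x - x₀‖ ^ 2) 1 := by
  obtain ⟨x₀, h₀, hu⟩ := id huni
  have hpos := hf.pos_of_isMode h₀
  have hmem : x₀ ∈ localModes f := by
    refine ⟨isConnected_singleton, f x₀, by simp, 1, one_pos, fun x hx => ?_⟩
    refine lt_of_le_of_ne (h₀ x) fun heq => hx.2 ?_
    exact hu x fun x' => heq ▸ h₀ x'
  obtain ⟨U, -, hU⟩ := hmodal.nhds
  obtain ⟨hUo, hxU, hd, hd', hH⟩ := hU x₀ hmem
  have hcrit : fderiv ℝ f x₀ = 0 :=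
    IsLocalMax.fderiv_eq_zero (Filter.Eventually.of_forall h₀)
  obtain ⟨ρ, hρ, c, hc, c', hc', hquad⟩ := exists_quadratic_bounds_of_hessian_neg hUo hxU hd
    (hd'.differentiableAt (hUo.mem_nhds hxU)) hcrit hH
  obtain ⟨m, hm, hgap⟩ := exists_gap_of_isUnimodal hsupp husc huni h₀ hpos hρ
  refine ⟨x₀, hpos, max c' (f x₀ / ρ ^ 2), lt_max_of_lt_left hc', min c m, lt_min hc hm,
    fun x => ?_⟩
  have hn := sq_nonneg ‖x - x₀‖
  rcases lt_or_ge ‖x - x₀‖ ρ with hx | hx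
  · obtain ⟨h1, h2⟩ := hquad x hx
    constructor
    · nlinarith [le_max_left c' (f x₀ / ρ ^ 2)]
    · have : min c m * min (‖x - x₀‖ ^ 2) 1 ≤ c * ‖x - x₀‖ ^ 2 :=
        mul_le_mul (min_le_left _ _) (min_le_left _ _) (le_min hn zero_le_one) hc.le
      linarith
  · constructor
    · have h1 : f x₀ ≤ max c' (f x₀ / ρ ^ 2) * ‖x - x₀‖ ^ 2 := by
        calc f x₀ = f x₀ / ρ ^ 2 * ρ ^ 2 := by field_simp
          _ ≤ _ := by gcongr; exact le_max_right _ _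
      linarith [hf.nonneg x]
    · have : min c m * min (‖x - x₀‖ ^ 2) 1 ≤ m * 1 :=
        mul_le_mul (min_le_right _ _) (min_le_right _ _) (le_min hn zero_le_one) hm.le
      linarith [hgap x hx]

/-! ### Grids in Euclidean space -/

open Classical in
/-- The points of the grid of step `1 / m` all of whose coordinates are at most `b` in absolute
value. -/
noncomputable def grid (D b m : ℕ) : Finset (EuclideanSpace ℝ (Fin D)) :=
  (Fintype.piFinset fun _ : Fin D => Finset.Icc (-(b * m : ℤ)) (b * m)).image
    fun v => WithLp.toLp 2 fun i => (v i : ℝ) / m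

theorem card_grid_le (D b m : ℕ) : (grid D b m).card ≤ (2 * b * m + 1) ^ D := by
  classical
  refine Finset.card_image_le.trans_eq ?_
  rw [Fintype.card_piFinset, Finset.prod_const, Int.card_Icc, Finset.card_univ, Fintype.card_fin]
  congr 1
  have : (b * m + 1 - -(b * m) : ℤ) = ((2 * b * m + 1 : ℕ) : ℤ) := by push_cast; ring
  rw [this, Int.toNat_natCast]

theorem exists_mem_grid {D b m : ℕ} (hm : 0 < m) {x : EuclideanSpace ℝ (Fin D)} (hx : ‖x‖ ≤ b) :
    ∃ y ∈ grid D b m, dist x y ≤ D / m := by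
  classical
  have hm' : (0 : ℝ) < m := Nat.cast_pos.2 hm
  refine ⟨WithLp.toLp 2 fun i => (⌊x i * m⌋ : ℝ) / m, ?_, ?_⟩
  · refine Finset.mem_image.2 ⟨fun i => ⌊x i * m⌋, ?_, rfl⟩
    rw [Fintype.mem_piFinset]
    intro i
    have hi := abs_le.1 ((PiLp.norm_apply_le x i).trans hx)
    rw [Finset.mem_Icc]
    constructor
    · rw [Int.le_floor]
      push_cast
      nlinarith [hi.1]
    · have : (⌊x i * m⌋ : ℝ) ≤ ((b * m : ℤ) : ℝ) := (Int.floor_le _).trans (by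
        push_cast
        nlinarith [hi.2])
      exact_mod_cast this
  · rw [EuclideanSpace.dist_eq]
    refine Real.sqrt_le_iff.2 ⟨by positivity, ?_⟩
    have hterm : ∀ i, dist (x i) ((⌊x i * m⌋ : ℝ) / m) ^ 2 ≤ (1 / m) ^ 2 := by
      intro i
      refine pow_le_pow_left₀ dist_nonneg ?_ 2
      have h1 := Int.floor_le (x i * m)
      have h2 := (Int.lt_floor_add_one (x i * m)).le
      rw [Real.dist_eq, abs_le]
      constructor
      · have : (⌊x i * m⌋ : ℝ) / m ≤ x i := (div_le_iff₀ hm').2 h1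
        have h3 : (0 : ℝ) ≤ 1 / m := by positivity
        linarith
      · have : x i ≤ ((⌊x i * m⌋ : ℝ) + 1) / m := (le_div_iff₀ hm').2 h2
        rw [add_div] at this
        linarith
    refine (Finset.sum_le_sum fun i _ => hterm i).trans ?_
    rw [Finset.sum_const, Finset.card_univ, Fintype.card_fin, nsmul_eq_mul, div_pow, div_pow,
      one_pow, mul_one_div]
    gcongr
    rcases Nat.eq_zero_or_pos D with rfl | hD
    · simp
    · exact le_self_pow₀ (by exact_mod_cast hD) two_ne_zero

/-! ### Localisation of the estimate by the sample -/

theorem IsDensity.isProbabilityMeasure {D : ℕ} {f : EuclideanSpace ℝ (Fin D) → ℝ}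
    (hf : IsDensity f) : IsProbabilityMeasure (densityMeasure f) :=
  ⟨by rw [densityMeasure, withDensity_apply _ MeasurableSet.univ, Measure.restrict_univ,
    hf.lintegral_eq_one]⟩

/-- The volume of the unit ball of `ℝ^D`. -/
noncomputable def unitBallVolume (D : ℕ) : ℝ :=
  (volume : Measure (EuclideanSpace ℝ (Fin D))).real (Metric.ball 0 1)

theorem unitBallVolume_pos (D : ℕ) : 0 < unitBallVolume D :=
  ENNReal.toReal_pos (Metric.measure_ball_pos _ _ one_pos).ne' measure_ball_lt_top.ne

theorem volume_closedBall_eq {D : ℕ} (y : EuclideanSpace ℝ (Fin D)) {s : ℝ} (hs : 0 ≤ s) :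
    volume (Metric.closedBall y s) = ENNReal.ofReal (s ^ D * unitBallVolume D) := by
  rw [Measure.addHaar_closedBall _ _ hs, finrank_euclideanSpace_fin,
    ENNReal.ofReal_mul (by positivity), unitBallVolume, Measure.real,
    ENNReal.ofReal_toReal measure_ball_lt_top.ne]

theorem IsDensity.le_measureReal_closedBall {D : ℕ} {f : EuclideanSpace ℝ (Fin D) → ℝ}
    (hf : IsDensity f) {y : EuclideanSpace ℝ (Fin D)} {s a : ℝ} (hs : 0 ≤ s) (ha : 0 ≤ a)
    (h : ∀ x ∈ Metric.closedBall y s, a ≤ f x) :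
    s ^ D * unitBallVolume D * a ≤ (densityMeasure f).real (Metric.closedBall y s) := by
  have := hf.isProbabilityMeasure
  rw [Measure.real, ← ENNReal.ofReal_le_iff_le_toReal (measure_ne_top _ _),
    densityMeasure, withDensity_apply _ Metric.isClosed_closedBall.measurableSet, mul_comm,
    ENNReal.ofReal_mul ha, ← volume_closedBall_eq y hs, ← setLIntegral_const]
  exact setLIntegral_mono (by have := hf.measurable; fun_prop) fun x hx =>
    ENNReal.ofReal_le_ofReal (h x hx)

theorem IsDensity.measureReal_closedBall_le {D : ℕ} {f : EuclideanSpace ℝ (Fin D) → ℝ}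
    (hf : IsDensity f) {y : EuclideanSpace ℝ (Fin D)} {s a : ℝ} (hs : 0 ≤ s)
    (h : ∀ x ∈ Metric.closedBall y s, f x ≤ a) :
    (densityMeasure f).real (Metric.closedBall y s) ≤ s ^ D * unitBallVolume D * a := by
  have := hf.isProbabilityMeasure
  have ha : 0 ≤ a := (hf.nonneg y).trans (h y (Metric.mem_closedBall_self hs))
  have hv := unitBallVolume_pos D
  refine ENNReal.toReal_le_of_le_ofReal (by positivity) ?_
  rw [densityMeasure, withDensity_apply _ Metric.isClosed_closedBall.measurableSet, mul_comm,
    ENNReal.ofReal_mul ha, ← volume_closedBall_eq y hs, ← setLIntegral_const]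
  exact setLIntegral_mono measurable_const fun x hx => ENNReal.ofReal_le_ofReal (h x hx)

/-- Samples from a compactly supported density almost surely lie in any set containing the
support. -/
theorem IsDensity.sampleMeasure_support {D n : ℕ} {f : EuclideanSpace ℝ (Fin D) → ℝ}
    (hf : IsDensity f) {K : Set (EuclideanSpace ℝ (Fin D))} (hK : MeasurableSet K)
    (hfK : ∀ x ∉ K, f x = 0) : sampleMeasure f n {x | ∀ i, x i ∈ K} = 1 := by
  have := hf.isProbabilityMeasure
  have h1 : densityMeasure f K = 1 := by
    rw [← prob_compl_eq_zero_iff hK, densityMeasure, withDensity_apply _ hK.compl]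
    rw [setLIntegral_congr_fun (g := fun _ => 0) hK.compl fun x hx => by simp [hfK x hx]]
    simp
  have h2 : {x : Fin n → EuclideanSpace ℝ (Fin D) | ∀ i, x i ∈ K} = Set.univ.pi fun _ => K := by
    ext x
    simp
  rw [h2, sampleMeasure, Measure.pi_pi]
  simp [h1]

theorem pow_sub_add_bounds {D : ℕ} (hD : 1 ≤ D) {r η τ : ℝ} (hr : 0 < r) (hη : 0 ≤ η)
    (hτ : τ ≤ 1) (h : η ≤ τ * r / (8 * D)) :
    r ^ D * (1 - τ / 4) ≤ (r - η) ^ D ∧ (r + η) ^ D ≤ r ^ D * (1 + τ / 4) := by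
  have hD' : (1 : ℝ) ≤ D := by exact_mod_cast hD
  set q := η / r with hq
  have hq0 : 0 ≤ q := by positivity
  have hηq : η = r * q := by rw [hq]; field_simp
  have hqD : D * q ≤ τ / 8 := by
    rw [hq]
    rw [le_div_iff₀ (by positivity)] at h
    rw [mul_div_assoc', div_le_iff₀ hr]
    linarith
  have hq1 : q ≤ 1 := by nlinarith
  constructor
  · have h1 := one_add_mul_le_pow (a := -q) (by linarith) D
    have h2 : r - η = r * (1 + -q) := by rw [hηq]; ring
    rw [h2, mul_pow]
    refine mul_le_mul_of_nonneg_left ?_ (by positivity)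
    nlinarith
  · have h2 : r + η = r * (1 + q) := by rw [hηq]; ring
    rw [h2, mul_pow]
    refine mul_le_mul_of_nonneg_left ?_ (by positivity)
    have h3 : 1 + q ≤ Real.exp q := by linarith [Real.add_one_le_exp q]
    have h4 : 0 ≤ D * q := by positivity
    calc (1 + q) ^ D ≤ Real.exp q ^ D := pow_le_pow_left₀ (by positivity) h3 D
      _ = Real.exp (D * q) := (Real.exp_nat_mul q D).symm
      _ ≤ 1 + D * q + (D * q) ^ 2 := by
        have := (abs_le.1 (Real.abs_exp_sub_one_sub_id_le (x := D * q)
          (abs_le.2 ⟨by linarith, by linarith⟩))).2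
        linarith
      _ ≤ 1 + τ / 4 := by nlinarith

section
variable {D n k : ℕ} {f : EuclideanSpace ℝ (Fin D) → ℝ} {x₀ : EuclideanSpace ℝ (Fin D)}
  {c₁ c₂ τ r η R : ℝ}

/-- Balls of radius almost `r` centred within `r` or so of the mode have expected count
exceeding `k` by the factor `1 + 2 * τ`. -/
theorem IsDensity.le_mean_near (hf : IsDensity f) (hD : 1 ≤ D)
    (hlow : ∀ x, f x₀ - c₁ * ‖x - x₀‖ ^ 2 ≤ f x) (hpos : 0 < f x₀) (hc₁ : 0 < c₁)
    (hτ0 : 0 < τ) (hτ : τ ≤ 1 / 20) (hr0 : 0 < r) (hη0 : 0 < η) (hη : η ≤ τ * r / (8 * D))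
    (hηr : η ≤ r)
    (hr : unitBallVolume D * f x₀ * n * r ^ D = k * (1 + 4 * τ))
    (hbias : 16 * c₁ * r ^ 2 ≤ τ * f x₀) {y : EuclideanSpace ℝ (Fin D)}
    (hy : dist y x₀ ≤ r + η) :
    k * (1 + 2 * τ) ≤ n * (densityMeasure f).real (Metric.closedBall y (r - η)) := by
  have hball : ∀ x ∈ Metric.closedBall y (r - η), f x₀ * (1 - τ / 4) ≤ f x := by
    intro x hx
    have h1 : ‖x - x₀‖ ≤ 2 * r := by
      rw [← dist_eq_norm]
      linarith [dist_triangle x y x₀, Metric.mem_closedBall.1 hx]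
    have h2 := pow_le_pow_left₀ (norm_nonneg _) h1 2
    have h3 := mul_le_mul_of_nonneg_left h2 hc₁.le
    linarith [hlow x]
  have h1 : 0 ≤ 1 - τ / 4 := by linarith
  have hv := unitBallVolume_pos D
  have h2 := hf.le_measureReal_closedBall (sub_nonneg.2 hηr) (by positivity) hball
  refine le_trans ?_ (mul_le_mul_of_nonneg_left h2 (Nat.cast_nonneg n))
  have h3 := (pow_sub_add_bounds hD hr0 hη0.le (by linarith) hη).1
  calc (k : ℝ) * (1 + 2 * τ) ≤ k * ((1 + 4 * τ) * (1 - τ / 4) * (1 - τ / 4)) := by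
        refine mul_le_mul_of_nonneg_left ?_ (Nat.cast_nonneg k)
        nlinarith [pow_pos hτ0 3]
    _ = n * (r ^ D * (1 - τ / 4) * unitBallVolume D * (f x₀ * (1 - τ / 4))) := by
        linear_combination (-(1 - τ / 4) ^ 2) * hr
    _ ≤ _ := by gcongr

/-- Balls of radius little more than `r` centred at distance almost `R` or more from the mode have
expected count below `k` by the factor `1 - 5 * τ`. -/
theorem IsDensity.mean_far_le (hf : IsDensity f) (hD : 1 ≤ D)
    (hup : ∀ x, f x ≤ f x₀ - c₂ * min (‖x - x₀‖ ^ 2) 1) (hpos : 0 < f x₀) (hc₂ : 0 < c₂)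
    (hτ0 : 0 < τ) (hτ : τ ≤ 1 / 20) (hr0 : 0 < r) (hη0 : 0 < η) (hη : η ≤ τ * r / (8 * D))
    (hr : unitBallVolume D * f x₀ * n * r ^ D = k * (1 + 4 * τ))
    (hR0 : 0 ≤ R) (hR2 : R ≤ 2) (hR : c₂ * R ^ 2 = 40 * τ * f x₀) (hrR : r + 2 * η ≤ R / 2)
    {y : EuclideanSpace ℝ (Fin D)} (hy : R - η ≤ dist y x₀) :
    n * (densityMeasure f).real (Metric.closedBall y (r + η)) ≤ k * (1 - 5 * τ) := by
  have hball : ∀ x ∈ Metric.closedBall y (r + η), f x ≤ f x₀ * (1 - 10 * τ) := by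
    intro x hx
    have h1 : R / 2 ≤ ‖x - x₀‖ := by
      rw [← dist_eq_norm]
      linarith [dist_triangle_left y x₀ x, Metric.mem_closedBall.1 hx]
    have h2 : R ^ 2 / 4 ≤ min (‖x - x₀‖ ^ 2) 1 := by
      refine le_min ?_ (by nlinarith)
      have := pow_le_pow_left₀ (by linarith) h1 2
      linarith
    have h3 := mul_le_mul_of_nonneg_left h2 hc₂.le
    linarith [hup x]
  have hv := unitBallVolume_pos D
  have h2 := hf.measureReal_closedBall_le (by positivity) hball
  refine (mul_le_mul_of_nonneg_left h2 (Nat.cast_nonneg n)).trans ?_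
  have h3 := (pow_sub_add_bounds hD hr0 hη0.le (by linarith) hη).2
  have h4 : 0 ≤ 1 - 10 * τ := by linarith
  calc _ ≤ n * (r ^ D * (1 + τ / 4) * unitBallVolume D * (f x₀ * (1 - 10 * τ))) := by gcongr
    _ = k * ((1 + 4 * τ) * (1 + τ / 4) * (1 - 10 * τ)) := by
        linear_combination ((1 + τ / 4) * (1 - 10 * τ)) * hr
    _ ≤ _ := by
        refine mul_le_mul_of_nonneg_left ?_ (Nat.cast_nonneg k)
        nlinarith [pow_pos hτ0 3, pow_pos hτ0 2]

/-- The event on which a sample separates the mode from all points at distance more than `R`: all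
centres within `r` of the mode have more than `k` sample points within distance `r`, while all
centres at distance more than `R` from it have fewer than `k - 1`, even within a slightly larger
distance. A union bound over a net `T` of spacing `η / 2` makes this uniform over the centres, the
radii of the balls absorbing the spacing. -/
theorem IsDensity.exists_separating_event (hf : IsDensity f) (hD : 1 ≤ D) {b : ℕ}
    (hsupp : ∀ x, b < ‖x‖ → f x = 0) (hpos : 0 < f x₀)
    (hlow : ∀ x, f x₀ - c₁ * ‖x - x₀‖ ^ 2 ≤ f x) (hc₁ : 0 < c₁)
    (hup : ∀ x, f x ≤ f x₀ - c₂ * min (‖x - x₀‖ ^ 2) 1) (hc₂ : 0 < c₂)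
    (hτ0 : 0 < τ) (hτ : τ ≤ 1 / 20) (hr0 : 0 < r) (hη0 : 0 < η) (hη : η ≤ τ * r / (8 * D))
    (hr : unitBallVolume D * f x₀ * n * r ^ D = k * (1 + 4 * τ))
    (hbias : 16 * c₁ * r ^ 2 ≤ τ * f x₀) (hr1 : r ≤ 1 / 2)
    (hR0 : 0 ≤ R) (hR2 : R ≤ 2) (hR : c₂ * R ^ 2 = 40 * τ * f x₀) (hrR : r ≤ R / 4)
    (hk : 1 < τ * k) {T : Finset (EuclideanSpace ℝ (Fin D))}
    (hT : ∀ x : EuclideanSpace ℝ (Fin D), ‖x‖ ≤ b + 2 → ∃ y ∈ T, dist x y ≤ η / 2) {δ : ℝ}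
    (hδ : 2 * T.card * Real.exp (-(τ ^ 2 * k / 12)) ≤ δ) :
    ∃ G : Set (Fin n → EuclideanSpace ℝ (Fin D)), MeasurableSet G ∧
      1 - ENNReal.ofReal δ ≤ sampleMeasure f n G ∧ ∀ x ∈ G,
        2 ≤ hits (Metric.closedBall x₀ r) x ∧
        (∀ p ∈ Metric.closedBall x₀ r, k + 1 ≤ hits (Metric.closedBall p r) x) ∧
        ∀ y, R < dist y x₀ → hits (Metric.closedBall y (r + η / 2)) x + 1 < k := by
  have hprob := hf.isProbabilityMeasure
  have hD' : (1 : ℝ) ≤ D := by exact_mod_cast hD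
  have hprob' : IsProbabilityMeasure (sampleMeasure f n) := by
    rw [sampleMeasure]; infer_instance
  have hk1 : (1 : ℝ) < k := by nlinarith [Nat.cast_nonneg (α := ℝ) k]
  have hηr : η ≤ r / 8 := by
    refine hη.trans ?_
    rw [div_le_div_iff₀ (by positivity) (by norm_num)]
    nlinarith
  set K : Set (EuclideanSpace ℝ (Fin D)) := Metric.closedBall 0 b with hKdef
  have hKm : MeasurableSet K := Metric.isClosed_closedBall.measurableSet
  set good : Set (Fin n → EuclideanSpace ℝ (Fin D)) := {x | ∀ i, x i ∈ K} with hgood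
  have hgoodm : MeasurableSet good := by
    have : good = Set.univ.pi fun _ => K := by ext x; simp [hgood]
    rw [this]
    exact MeasurableSet.univ_pi fun _ => hKm
  set few : EuclideanSpace ℝ (Fin D) → Set (Fin n → EuclideanSpace ℝ (Fin D)) := fun y =>
    {x | dist y x₀ ≤ r + η ∧
      (hits (Metric.closedBall y (r - η)) x : ℝ) ≤ k * (1 + 2 * τ) - τ * k} with hfew
  set many : EuclideanSpace ℝ (Fin D) → Set (Fin n → EuclideanSpace ℝ (Fin D)) := fun y =>
    {x | R - η ≤ dist y x₀ ∧
      k * (1 - 5 * τ) + τ * k ≤ (hits (Metric.closedBall y (r + η)) x : ℝ)} with hmany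
  have hfewm : ∀ y, MeasurableSet (few y) := fun y =>
    (MeasurableSet.const _).inter (measurableSet_le
      (measurable_hits Metric.isClosed_closedBall.measurableSet) measurable_const)
  have hmanym : ∀ y, MeasurableSet (many y) := fun y =>
    (MeasurableSet.const _).inter (measurableSet_le measurable_const
      (measurable_hits Metric.isClosed_closedBall.measurableSet))
  have hfewle : ∀ y, sampleMeasure f n (few y) ≤
      ENNReal.ofReal (Real.exp (-(τ ^ 2 * k / 12))) := by
    intro y
    by_cases hy : dist y x₀ ≤ r + η
    · have h1 := measureReal_hits_le_le (densityMeasure f) n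
        (Metric.isClosed_closedBall (x := y) (ε := r - η)).measurableSet
        (hf.le_mean_near hD hlow hpos hc₁ hτ0 hτ hr0 hη0 hη (by linarith) hr hbias hy)
        (by positivity) (t := τ * k) (by positivity) (by nlinarith)
      refine (measure_mono fun x hx => hx.2).trans
        ((ENNReal.le_ofReal_iff_toReal_le (measure_ne_top _ _) (Real.exp_pos _).le).2
          (h1.trans (Real.exp_le_exp.2 (neg_le_neg ?_))))
      rw [div_le_div_iff₀ (by norm_num) (by positivity)]
      have : 0 ≤ τ ^ 2 * k ^ 2 := by positivity
      nlinarith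
    · have : few y = ∅ := Set.eq_empty_of_forall_notMem fun x hx => hy hx.1
      simp [this]
  have hmanyle : ∀ y, sampleMeasure f n (many y) ≤
      ENNReal.ofReal (Real.exp (-(τ ^ 2 * k / 12))) := by
    intro y
    by_cases hy : R - η ≤ dist y x₀
    · have h1 := measureReal_hits_ge_le (densityMeasure f) n
        (Metric.isClosed_closedBall (x := y) (ε := r + η)).measurableSet
        (hf.mean_far_le hD hup hpos hc₂ hτ0 hτ hr0 hη0 hη hr hR0 hR2 hR (by linarith) hy)
        (m := k) (by nlinarith) (by positivity) (t := τ * k) (by positivity) (by nlinarith)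
      refine (measure_mono fun x hx => hx.2).trans
        ((ENNReal.le_ofReal_iff_toReal_le (measure_ne_top _ _) (Real.exp_pos _).le).2
          (h1.trans (Real.exp_le_exp.2 (neg_le_neg ?_))))
      rw [div_le_div_iff₀ (by norm_num) (by positivity)]
      have : 0 ≤ τ ^ 2 * k ^ 2 := by positivity
      nlinarith
    · have : many y = ∅ := Set.eq_empty_of_forall_notMem fun x hx => hy hx.1
      simp [this]
  set bad : Set (Fin n → EuclideanSpace ℝ (Fin D)) := ⋃ y ∈ T, few y ∪ many y with hbad
  have hbadm : MeasurableSet bad :=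
    Finset.measurableSet_biUnion _ fun y _ => (hfewm y).union (hmanym y)
  have hbadle : sampleMeasure f n bad ≤ ENNReal.ofReal δ := by
    refine (measure_biUnion_finset_le _ _).trans ?_
    refine (Finset.sum_le_sum fun y _ => (measure_union_le _ _).trans
      (add_le_add (hfewle y) (hmanyle y))).trans ?_
    rw [Finset.sum_const, ← ENNReal.ofReal_add (Real.exp_pos _).le (Real.exp_pos _).le,
      ← ENNReal.ofReal_nsmul]
    refine ENNReal.ofReal_le_ofReal (le_trans (le_of_eq ?_) hδ)
    rw [nsmul_eq_mul]
    ring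
  refine ⟨good \ bad, hgoodm.diff hbadm, ?_, fun x hx => ?_⟩
  · have h1 : sampleMeasure f n good = 1 := hf.sampleMeasure_support hKm fun x hx =>
      hsupp x (by simpa [hKdef] using hx)
    rw [← h1]
    exact (tsub_le_tsub_left hbadle _).trans le_measure_sdiff
  · obtain ⟨hxg, hxb⟩ := hx
    have hxfew : ∀ y ∈ T, x ∉ few y := fun y hy h =>
      hxb (Set.mem_biUnion hy (Or.inl h))
    have hxmany : ∀ y ∈ T, x ∉ many y := fun y hy h =>
      hxb (Set.mem_biUnion hy (Or.inr h))
    have hx₀ : ‖x₀‖ ≤ b := by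
      by_contra h
      rw [hsupp x₀ (not_le.1 h)] at hpos
      exact lt_irrefl _ hpos
    have hnear : ∀ p ∈ Metric.closedBall x₀ r, k + 1 ≤ hits (Metric.closedBall p r) x := by
      intro p hp
      rw [Metric.mem_closedBall] at hp
      have hpn : ‖p‖ ≤ b + 2 := by
        have := norm_le_norm_add_norm_sub x₀ p
        rw [← dist_eq_norm, dist_comm] at this
        linarith
      obtain ⟨y, hyT, hy⟩ := hT p hpn
      have h1 : dist y x₀ ≤ r + η := by linarith [dist_triangle_left y x₀ p]
      have h2 : ¬ (hits (Metric.closedBall y (r - η)) x : ℝ) ≤ k * (1 + 2 * τ) - τ * k :=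
        fun h => hxfew y hyT ⟨h1, h⟩
      have h3 : hits (Metric.closedBall y (r - η)) x ≤ hits (Metric.closedBall p r) x :=
        hits_mono (Metric.closedBall_subset_closedBall' (by
          rw [dist_comm]; linarith)) x
      have h4 : (k : ℝ) < hits (Metric.closedBall y (r - η)) x := by linarith
      have h5 : k < hits (Metric.closedBall y (r - η)) x := by exact_mod_cast h4
      omega
    refine ⟨?_, hnear, fun y hy => ?_⟩
    · have h1 := hnear x₀ (Metric.mem_closedBall_self hr0.le)
      have h2 : 1 < k := by exact_mod_cast hk1
      omega
    · by_cases hyn : ‖y‖ ≤ b + 2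
      · obtain ⟨z, hzT, hz⟩ := hT y hyn
        have h1 : R - η ≤ dist z x₀ := by linarith [dist_triangle y z x₀]
        have h2 : ¬ k * (1 - 5 * τ) + τ * k ≤ (hits (Metric.closedBall z (r + η)) x : ℝ) :=
          fun h => hxmany z hzT ⟨h1, h⟩
        have h3 : hits (Metric.closedBall y (r + η / 2)) x ≤ hits (Metric.closedBall z (r + η)) x :=
          hits_mono (Metric.closedBall_subset_closedBall' (by linarith)) x
        have h4 : (hits (Metric.closedBall z (r + η)) x : ℝ) + 1 < k := by linarith
        have h5 : hits (Metric.closedBall z (r + η)) x + 1 < k := by exact_mod_cast h4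
        omega
      · -- the ball is disjoint from the support, hence from the sample
        have h0 : hits (Metric.closedBall y (r + η / 2)) x = 0 := by
          classical
          rw [hits, Finset.card_eq_zero, Finset.filter_eq_empty_iff]
          intro i _ hi
          have h1 : ‖x i‖ ≤ b := by simpa [hKdef] using hxg i
          rw [Metric.mem_closedBall, dist_comm, dist_eq_norm] at hi
          have h2 := norm_le_norm_add_norm_sub (x i) y
          rw [norm_sub_rev] at h2
          linarith
        rw [h0]
        have h2 : 1 < k := by exact_mod_cast hk1
        omega
end

/-- The trivial localisation: almost surely all data lie in a fixed ball `B(0, b)`, and then the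
estimate stays in `B(0, 3 * b + 1)` when one point is changed. -/
theorem IsDensity.exists_bounding_event {D : ℕ} {f : EuclideanSpace ℝ (Fin D) → ℝ}
    (hf : IsDensity f) {b n k : ℕ} (hsupp : ∀ x, b < ‖x‖ → f x = 0) (hk : 2 ≤ k) (hkn : k + 1 ≤ n) :
    ∃ G : Set (Fin n → EuclideanSpace ℝ (Fin D)), MeasurableSet G ∧ sampleMeasure f n G = 1 ∧
      ∀ x ∈ G, 2 ≤ hits (Metric.closedBall 0 b) x ∧
        (∀ p ∈ Metric.closedBall 0 (b : ℝ), k + 1 ≤ hits (Metric.closedBall p (2 * b)) x) ∧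
        ∀ y, 3 * b + 1 < dist y 0 → hits (Metric.closedBall y (2 * b + 1)) x + 1 < k := by
  classical
  set K : Set (EuclideanSpace ℝ (Fin D)) := Metric.closedBall 0 b with hKdef
  have hKm : MeasurableSet K := Metric.isClosed_closedBall.measurableSet
  refine ⟨{x | ∀ i, x i ∈ K}, ?_, hf.sampleMeasure_support hKm fun x hx =>
      hsupp x (by simpa [hKdef] using hx), fun x hx => ?_⟩
  · have : {x : Fin n → EuclideanSpace ℝ (Fin D) | ∀ i, x i ∈ K} = Set.univ.pi fun _ => K := by
      ext x; simp
    rw [this]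
    exact MeasurableSet.univ_pi fun _ => hKm
  · have hall : hits K x = n := by
      rw [hits, Finset.filter_true_of_mem fun i _ => hx i, Finset.card_univ, Fintype.card_fin]
    refine ⟨by omega, fun p hp => ?_, fun y hy => ?_⟩
    · have h1 : K ⊆ Metric.closedBall p (2 * b) := Metric.closedBall_subset_closedBall' (by
        rw [dist_comm]; linarith [Metric.mem_closedBall.1 hp])
      have h2 := hits_mono h1 x
      omega
    · have h0 : hits (Metric.closedBall y (2 * b + 1)) x = 0 := by
        rw [hits, Finset.card_eq_zero, Finset.filter_eq_empty_iff]
        intro i _ hi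
        have h1 := Metric.mem_closedBall.1 (hx i)
        linarith [dist_triangle_left y 0 (x i), Metric.mem_closedBall.1 hi]
      omega

/-! ### Choice of the parameters -/

/-- The upper bound on `k` cleared of real exponents. -/
theorem pow_le_of_le_rpow {D k n : ℕ} {a l g : ℝ} (ha : 0 ≤ a) (hl : 0 ≤ l) (hg : 0 ≤ g)
    (h : (k : ℝ) ≤ a ^ (2 * D / (4 + D) : ℝ) * l ^ (2 * D / (4 + D) : ℝ) *
      g ^ (D / (4 + D) : ℝ) * (n : ℝ) ^ (4 / (4 + D) : ℝ)) :
    (k : ℝ) ^ (4 + D) ≤ a ^ (2 * D) * l ^ (2 * D) * g ^ D * (n : ℝ) ^ 4 := by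
  have key : ∀ (x : ℝ) (p : ℕ), 0 ≤ x → (x ^ ((p : ℝ) / (4 + D) : ℝ)) ^ (4 + D) = x ^ p := by
    intro x p hx
    rw [← Real.rpow_natCast, ← Real.rpow_mul hx, ← Real.rpow_natCast]
    congr 1
    push_cast
    field_simp
  have h1 := pow_le_pow_left₀ (Nat.cast_nonneg k) h (4 + D)
  rw [mul_pow, mul_pow, mul_pow] at h1
  have e1 := key a (2 * D) ha
  have e2 := key l (2 * D) hl
  have e3 := key g D hg
  have e4 := key n 4 (Nat.cast_nonneg n)
  push_cast at e1 e2 e4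
  rwa [e1, e2, e3, e4] at h1

/-- The two bounds on `k` together make it at most half the sample size. -/
theorem two_mul_le_of_pow_le {D k n : ℕ} (hD : 1 ≤ D) {a l g : ℝ} (ha : 0 ≤ a) (ha4 : a ≤ 1 / 4)
    (hg : 0 ≤ g) (hk : 1 ≤ k) (hlk : l ^ 2 * g ≤ k)
    (h : (k : ℝ) ^ (4 + D) ≤ a ^ (2 * D) * l ^ (2 * D) * g ^ D * (n : ℝ) ^ 4) : 2 * k ≤ n := by
  have hk0 : (0 : ℝ) < k := by exact_mod_cast hk
  have h1 : a ^ (2 * D) ≤ (1 / 2) ^ 4 := by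
    calc a ^ (2 * D) ≤ a ^ 2 := pow_le_pow_of_le_one ha (by linarith) (by omega)
      _ ≤ (1 / 4) ^ 2 := pow_le_pow_left₀ ha ha4 2
      _ = _ := by norm_num
  have h2 : l ^ (2 * D) * g ^ D ≤ (k : ℝ) ^ D := by
    rw [pow_mul, ← mul_pow]
    exact pow_le_pow_left₀ (by positivity) hlk D
  have h3 : (k : ℝ) ^ 4 * k ^ D ≤ ((1 / 2) * n) ^ 4 * k ^ D := by
    calc (k : ℝ) ^ 4 * k ^ D = k ^ (4 + D) := (pow_add _ _ _).symm
      _ ≤ a ^ (2 * D) * (l ^ (2 * D) * g ^ D) * (n : ℝ) ^ 4 := by rw [← mul_assoc]; exact h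
      _ ≤ (1 / 2) ^ 4 * k ^ D * (n : ℝ) ^ 4 := by
        gcongr
        rw [pow_mul]
        positivity
      _ = _ := by ring
  have h4 := le_of_mul_le_mul_right h3 (by positivity)
  have h5 := (pow_le_pow_iff_left₀ hk0.le (by positivity) (by norm_num)).1 h4
  have h6 : (2 * k : ℝ) ≤ n := by linarith
  exact_mod_cast h6

/-- The upper bound on `k` makes the squared radius `r ^ 2`, hence the bias, at most of the order of
the statistical precision `τ`. The comparison is made after raising to the power `2 * D`, which
clears all roots. -/
theorem sq_radius_le {D k n : ℕ} (hD : 1 ≤ D) {a l g L c q r τ : ℝ} (hk : 1 ≤ k) (hn : 1 ≤ n)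
    (hr : 0 ≤ r) (hτ : 0 ≤ τ) (hc : 0 ≤ c) (hg : 0 ≤ g) (hl : 0 ≤ l) (hlL : l ≤ L) (ha : 0 ≤ a)
    (hq : 1 ≤ q) (haq : a * q ^ 2 ≤ 24 * D * c) (hτk : τ ^ 2 * k = (24 * D * L) ^ 2 * g)
    (hrD : r ^ D * n ≤ q * k)
    (h : (k : ℝ) ^ (4 + D) ≤ a ^ (2 * D) * l ^ (2 * D) * g ^ D * (n : ℝ) ^ 4) :
    r ^ 2 ≤ c * τ := by
  have hk0 : (0 : ℝ) < k := by exact_mod_cast hk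
  have hn0 : (0 : ℝ) < n := by exact_mod_cast hn
  have hL : 0 ≤ L := hl.trans hlL
  have h1 : q ^ 4 ≤ (q ^ 2) ^ (2 * D) := by
    rw [← pow_mul]
    exact pow_le_pow_right₀ hq (by omega)
  have h2 : (r ^ 2) ^ (2 * D) * (n ^ 4 * k ^ D) ≤ (c * τ) ^ (2 * D) * (n ^ 4 * (k : ℝ) ^ D) := by
    calc (r ^ 2) ^ (2 * D) * (n ^ 4 * (k : ℝ) ^ D) = (r ^ D * n) ^ 4 * k ^ D := by ring
      _ ≤ (q * k) ^ 4 * k ^ D := by gcongr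
      _ = q ^ 4 * k ^ (4 + D) := by ring
      _ ≤ (q ^ 2) ^ (2 * D) * (a ^ (2 * D) * l ^ (2 * D) * g ^ D * (n : ℝ) ^ 4) := by gcongr
      _ ≤ (q ^ 2) ^ (2 * D) * (a ^ (2 * D) * L ^ (2 * D) * g ^ D * (n : ℝ) ^ 4) := by gcongr
      _ = (a * q ^ 2) ^ (2 * D) * (L ^ (2 * D) * g ^ D * (n : ℝ) ^ 4) := by ring
      _ ≤ (24 * D * c) ^ (2 * D) * (L ^ (2 * D) * g ^ D * (n : ℝ) ^ 4) := by gcongr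
      _ = c ^ (2 * D) * ((24 * D * L) ^ 2 * g) ^ D * n ^ 4 := by
        rw [mul_pow ((24 * D * L) ^ 2), ← pow_mul]
        ring
      _ = (c * τ) ^ (2 * D) * (n ^ 4 * (k : ℝ) ^ D) := by
        rw [← hτk]
        ring
  have h3 := le_of_mul_le_mul_right h2 (by positivity)
  exact (pow_le_pow_iff_left₀ (by positivity) (by positivity) (by omega)).1 h3

/-- The union bound over the net: the exponent `τ ^ 2 * k / 12 = 48 * (D * L) ^ 2 * log n` beats the
logarithm of the size of a net of polynomial size. -/
theorem union_bound_le {D n m : ℕ} (hD : 1 ≤ D) {δ x : ℝ} (hδ : 0 < δ)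
    (hL : 1 / 2 ≤ Real.log (2 / δ)) (hn : 0 < n) (hlog : 1 ≤ Real.log n) (hm : m ≤ n ^ (6 * D))
    (hx : x = (24 * D * Real.log (2 / δ)) ^ 2 * Real.log n) :
    2 * m * Real.exp (-(x / 12)) ≤ δ := by
  set L := Real.log (2 / δ) with hLdef
  have hD' : (1 : ℝ) ≤ D := by exact_mod_cast hD
  have hn0 : (0 : ℝ) < n := by exact_mod_cast hn
  have h1 : L + (6 * D : ℕ) * Real.log n ≤ x / 12 := by
    push_cast
    have hDL : D / 2 ≤ D * L := by nlinarith
    have h2 : L ≤ 2 * (D * L) ^ 2 := by nlinarith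
    have h3 : (D : ℝ) ≤ 4 * (D * L) ^ 2 := by nlinarith
    have h4 : 2 * (D * L) ^ 2 ≤ 2 * (D * L) ^ 2 * Real.log n :=
      le_mul_of_one_le_right (by positivity) hlog
    have h5 := mul_le_mul_of_nonneg_right h3 (by linarith : (0 : ℝ) ≤ Real.log n)
    have h6 : 0 ≤ (D * L) ^ 2 * Real.log n := by positivity
    rw [hx]
    nlinarith
  have h2 : Real.exp (L + (6 * D : ℕ) * Real.log n) = 2 / δ * n ^ (6 * D) := by
    rw [Real.exp_add, hLdef, Real.exp_log (by positivity), Real.exp_nat_mul, Real.exp_log hn0]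
  have h3 : Real.exp (-(x / 12)) ≤ (2 / δ * n ^ (6 * D))⁻¹ := by
    rw [← h2, ← Real.exp_neg]
    exact Real.exp_le_exp.2 (neg_le_neg h1)
  have h4 : (m : ℝ) ≤ (n : ℝ) ^ (6 * D) := by exact_mod_cast hm
  calc 2 * m * Real.exp (-(x / 12)) ≤ 2 * n ^ (6 * D) * (2 / δ * n ^ (6 * D))⁻¹ := by gcongr
    _ = δ := by field_simp

/-- Radii are resolved at the scale `1 / n ^ 3`: this spacing changes the volume of a ball of radius
`r` by a factor much closer to `1` than `1 ± τ`. -/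
theorem resolution_le {D k n : ℕ} (hD : 1 ≤ D) {V r w L τ g : ℝ} (hn : 1 ≤ n) (hk : 1 ≤ k)
    (hkn : k ≤ n) (hVn : V ≤ n) (hV : 0 < V) (hr : 0 < r) (hw : 0 < w) (hL : 1 / 2 ≤ L)
    (hg : 1 ≤ g) (hwk : w ^ 4 * k = g) (hτ : τ = 24 * D * L * w ^ 2)
    (hrD : V * n * r ^ D = k * (1 + 4 * τ)) : 1 / (n : ℝ) ^ 3 ≤ τ * r / (8 * D) := by
  have hD' : (1 : ℝ) ≤ D := by exact_mod_cast hD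
  have hn1 : (1 : ℝ) ≤ n := by exact_mod_cast hn
  have hn0 : (0 : ℝ) < n := by linarith
  have hk1 : (1 : ℝ) ≤ k := by exact_mod_cast hk
  have hkn' : (k : ℝ) ≤ n := by exact_mod_cast hkn
  have hτ0 : 0 < τ := by rw [hτ]; positivity
  have hrn : 1 / (n : ℝ) ^ 2 ≤ r := by
    refine (pow_le_pow_iff_left₀ (by positivity) hr.le (by omega : D ≠ 0)).1 ?_
    have h1 : (1 / (n : ℝ) ^ 2) ^ D ≤ 1 / (n : ℝ) ^ 2 :=
      pow_le_of_le_one (by positivity) (by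
        rw [div_le_one (by positivity)]
        exact one_le_pow₀ hn1) (by omega)
    refine h1.trans ?_
    rw [div_le_iff₀ (by positivity)]
    calc (1 : ℝ) ≤ k * (1 + 4 * τ) := by nlinarith
      _ = V * n * r ^ D := hrD.symm
      _ ≤ n * n * r ^ D := by gcongr
      _ = r ^ D * n ^ 2 := by ring
  have hwn : 1 / (n : ℝ) ≤ w ^ 2 := by
    refine (pow_le_pow_iff_left₀ (by positivity) (by positivity) two_ne_zero).1 ?_
    rw [div_pow, one_pow, div_le_iff₀ (by positivity), ← pow_mul]
    calc (1 : ℝ) ≤ g := hg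
      _ = w ^ 4 * k := hwk.symm
      _ ≤ w ^ 4 * n ^ 2 := by
        gcongr
        nlinarith
  have h1 : τ * r / (8 * D) = 3 * L * (w ^ 2 * r) := by
    rw [hτ]
    field_simp
    ring
  have h2 : 1 / (n : ℝ) * (1 / (n : ℝ) ^ 2) ≤ w ^ 2 * r := by gcongr
  have h3 : 1 / (n : ℝ) * (1 / (n : ℝ) ^ 2) = 1 / (n : ℝ) ^ 3 := by field_simp
  have h4 : 0 < 1 / (n : ℝ) ^ 3 := by positivity
  rw [h3] at h2
  rw [h1]
  nlinarith

/-- A net of polynomial size and of spacing `1 / (2 * n ^ 3)` in a fixed ball. -/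
theorem exists_net {D b n : ℕ} (hn : 1 ≤ n) (hnD : 2 * D ≤ n) (hnb : 2 * b + 5 ≤ n) :
    ∃ T : Finset (EuclideanSpace ℝ (Fin D)), T.card ≤ n ^ (6 * D) ∧
      ∀ x : EuclideanSpace ℝ (Fin D), ‖x‖ ≤ b + 2 → ∃ y ∈ T, dist x y ≤ 1 / (n : ℝ) ^ 3 / 2 := by
  refine ⟨grid D (b + 2) (n ^ 4), (card_grid_le _ _ _).trans ?_, fun x hx => ?_⟩
  · rw [pow_mul]
    refine Nat.pow_le_pow_left ?_ D
    have h1 : 1 ≤ n ^ 4 := Nat.one_le_pow _ _ (by omega)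
    calc 2 * (b + 2) * n ^ 4 + 1 ≤ (2 * b + 5) * n ^ 4 := by nlinarith
      _ ≤ n * n ^ 4 := Nat.mul_le_mul_right _ hnb
      _ = n ^ 5 := by ring
      _ ≤ n ^ 6 := Nat.pow_le_pow_right (by omega) (by norm_num)
  · obtain ⟨y, hy, hxy⟩ := exists_mem_grid (D := D) (b := b + 2) (m := n ^ 4) (by positivity)
      (x := x) (by push_cast; exact hx)
    refine ⟨y, hy, hxy.trans ?_⟩
    have h1 : (2 * D : ℝ) ≤ n := by exact_mod_cast hnD
    rw [div_div, Nat.cast_pow, div_le_div_iff₀ (by positivity) (by positivity)]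
    have h2 : (0 : ℝ) < n ^ 3 := by positivity
    nlinarith

/-- The main regime, where the precision `τ = 24 * D * L * w ^ 2` with `w = (log n / k) ^ (1 / 4)`
is below a constant depending on the density: the estimate is localised at the scale `R ~ √τ` around
the mode. -/
theorem IsDensity.exists_event_of_precision_le {D n k b : ℕ} {f : EuclideanSpace ℝ (Fin D) → ℝ}
    {x₀ : EuclideanSpace ℝ (Fin D)} {c₁ c₂ c q a w δ : ℝ}
    (hf : IsDensity f) (hD : 1 ≤ D)
    (hsupp : ∀ x, b < ‖x‖ → f x = 0) (hpos : 0 < f x₀)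
    (hlow : ∀ x, f x₀ - c₁ * ‖x - x₀‖ ^ 2 ≤ f x) (hc₁ : 0 < c₁)
    (hup : ∀ x, f x ≤ f x₀ - c₂ * min (‖x - x₀‖ ^ 2) 1) (hc₂ : 0 < c₂)
    (hn3 : 3 ≤ n) (hnD : 2 * D ≤ n) (hnb : 2 * b + 5 ≤ n) (hnv : unitBallVolume D * f x₀ ≤ n)
    (hlog : 1 ≤ Real.log n) (hk : 1 ≤ k) (hkn : k ≤ n) (hδ : 0 < δ) (hδ1 : δ < 1)
    (hw : 0 < w) (hwk : w ^ 4 * k = Real.log n)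
    (hc : 0 < c) (hcc₁ : 16 * c₁ * c ≤ f x₀) (hcc₂ : 16 * c * c₂ ≤ 40 * f x₀)
    (hq : 1 ≤ q) (hq5 : 5 ≤ q * (unitBallVolume D * f x₀)) (ha : 0 ≤ a)
    (haq : a * q ^ 2 ≤ 24 * D * c)
    (hkpow : (k : ℝ) ^ (4 + D) ≤
      a ^ (2 * D) * Real.log (1 / δ) ^ (2 * D) * Real.log n ^ D * (n : ℝ) ^ 4)
    (hτ : 24 * D * Real.log (2 / δ) * w ^ 2 ≤ 1 / 20)
    (hτ2 : 10 * f x₀ * (24 * D * Real.log (2 / δ) * w ^ 2) ≤ c₂) :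
    ∃ (G : Set (Fin n → EuclideanSpace ℝ (Fin D))) (r r' R : ℝ), MeasurableSet G ∧
      1 - ENNReal.ofReal δ ≤ sampleMeasure f n G ∧ 0 ≤ r ∧ r < r' ∧
      c₂ * R ^ 2 = 40 * (24 * D * Real.log (2 / δ) * w ^ 2) * f x₀ ∧ ∀ x ∈ G,
        2 ≤ hits (Metric.closedBall x₀ r) x ∧
        (∀ p ∈ Metric.closedBall x₀ r, k + 1 ≤ hits (Metric.closedBall p r) x) ∧
        ∀ y, R < dist y x₀ → hits (Metric.closedBall y r') x + 1 < k := by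
  have hD' : (1 : ℝ) ≤ D := by exact_mod_cast hD
  have hn0 : (0 : ℝ) < n := by exact_mod_cast (by omega : 0 < n)
  have hn1 : (1 : ℝ) ≤ n := by exact_mod_cast (by omega : 1 ≤ n)
  have hk1 : (1 : ℝ) ≤ k := by exact_mod_cast hk
  have hkn' : (k : ℝ) ≤ n := by exact_mod_cast hkn
  have hl0 : 0 ≤ Real.log (1 / δ) := Real.log_nonneg (by rw [le_div_iff₀ hδ]; linarith)
  have hlL : Real.log (1 / δ) ≤ Real.log (2 / δ) :=
    Real.log_le_log (by positivity) (by gcongr; norm_num)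
  have hL2 : 1 / 2 ≤ Real.log (2 / δ) := by
    have h2 : Real.log 2 ≤ Real.log (2 / δ) := Real.log_le_log (by norm_num) (by
      rw [le_div_iff₀ hδ]; linarith)
    linarith [Real.log_two_gt_d9]
  set L := Real.log (2 / δ) with hL
  set τ := 24 * D * L * w ^ 2 with hτdef
  set V := unitBallVolume D * f x₀ with hV
  have hV0 : 0 < V := mul_pos (unitBallVolume_pos D) hpos
  have hτ0 : 0 < τ := by positivity
  have hτk : τ ^ 2 * k = (24 * D * L) ^ 2 * Real.log n := by
    rw [← hwk, hτdef]
    ring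
  have hub : ∀ m : ℕ, m ≤ n ^ (6 * D) → 2 * m * Real.exp (-(τ ^ 2 * k / 12)) ≤ δ := fun m hm =>
    union_bound_le hD hδ hL2 (by omega) hlog hm hτk
  clear_value τ L
  -- a ball of radius `r` on which the density equals its maximum has expected count
  -- `k * (1 + 4 * τ)`
  set r : ℝ := (k * (1 + 4 * τ) / (V * n)) ^ ((D : ℝ)⁻¹) with hrdef
  have hr0 : 0 < r := by positivity
  have hrD : r ^ D = k * (1 + 4 * τ) / (V * n) :=
    Real.rpow_inv_natCast_pow (by positivity) (by omega)
  clear_value r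
  have hr2 : r ^ 2 ≤ c * τ := by
    refine sq_radius_le hD hk (by omega) hr0.le hτ0.le hc.le (by linarith) hl0 hlL ha hq haq hτk ?_
      hkpow
    have h1 : r ^ D * n = k * (1 + 4 * τ) / V := by rw [hrD]; field_simp
    have h2 := mul_le_mul_of_nonneg_left hq5 (Nat.cast_nonneg (α := ℝ) k)
    have h3 : k * (1 + 4 * τ) ≤ k * 5 :=
      mul_le_mul_of_nonneg_left (by linarith only [hτ]) (Nat.cast_nonneg k)
    rw [h1, div_le_iff₀ hV0]
    linarith only [h2, h3]
  have hrV : V * n * r ^ D = k * (1 + 4 * τ) := by rw [hrD]; field_simp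
  -- at distance `R / 2` from the mode the density has dropped by the factor `1 - 10 * τ`, which
  -- outweighs the factor `1 + 4 * τ` in the choice of `r` and the fluctuations of order `τ`
  set R : ℝ := √(40 * τ * f x₀ / c₂) with hRdef
  have hR : R ^ 2 = 40 * τ * f x₀ / c₂ := Real.sq_sqrt (by positivity)
  have hR' : c₂ * R ^ 2 = 40 * τ * f x₀ := by rw [hR]; field_simp
  have hR0 : 0 ≤ R := Real.sqrt_nonneg _
  clear_value R
  have hR2 : R ≤ 2 := by
    refine (pow_le_pow_iff_left₀ hR0 zero_le_two two_ne_zero).1 ?_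
    rw [hR, div_le_iff₀ hc₂]
    linarith
  have hrR : r ≤ R / 4 := by
    refine (pow_le_pow_iff_left₀ hr0.le (by positivity) two_ne_zero).1 (hr2.trans ?_)
    have h1 := mul_le_mul_of_nonneg_right hcc₂ hτ0.le
    rw [div_pow, hR, div_div, le_div_iff₀ (by positivity)]
    linarith only [h1]
  have hbias : 16 * c₁ * r ^ 2 ≤ τ * f x₀ := by
    calc 16 * c₁ * r ^ 2 ≤ 16 * c₁ * (c * τ) := by gcongr
      _ = 16 * c₁ * c * τ := by ring
      _ ≤ f x₀ * τ := by gcongr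
      _ = _ := mul_comm _ _
  set η : ℝ := 1 / n ^ 3 with hηdef
  have hη0 : 0 < η := by positivity
  have hη : η ≤ τ * r / (8 * D) :=
    resolution_le hD (by omega) hk hkn hnv hV0 hr0 hw hL2 hlog hwk hτdef hrV
  have hk' : 1 < τ * k := by
    have h2 : 12 ≤ 24 * D * L := by nlinarith only [hD', hL2]
    have h1 : 1 < τ ^ 2 * k := by
      rw [hτk]
      nlinarith only [h2, hlog]
    have h3 : τ ^ 2 * k = τ * (τ * k) := by ring
    by_contra hcon
    have h4 := mul_le_mul_of_nonneg_left (not_lt.1 hcon) hτ0.le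
    linarith only [h1, h3, h4, hτ]
  obtain ⟨T, hcard, hT⟩ := exists_net (D := D) (by omega) hnD hnb
  obtain ⟨G, hGm, hG, hGx⟩ := hf.exists_separating_event (n := n) (k := k) hD hsupp hpos hlow hc₁
    hup hc₂ hτ0 hτ hr0 hη0 hη hrV hbias (by linarith) hR0 hR2 hR' hrR hk' hT
    (hub _ hcard)
  exact ⟨G, r, r + η / 2, R, hGm, hG, hr0.le, by linarith, hR', hGx⟩

/-! ### Privacy at a typical sample -/

theorem mainTheorem2 (D : ℕ) (hD : 1 ≤ D) (f : EuclideanSpace ℝ (Fin D) → ℝ)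
    (hf : IsDensity f) (hsupp : HasCompactSupport f) (husc : UpperSemicontinuous f)
    (huni : IsUnimodal f) (hmodal : ModalStructure f) :
    ∃ C C₁ C₂ : ℝ, 0 < C ∧ 0 < C₁ ∧ 0 < C₂ ∧ ∃ N : ℕ, ∀ n : ℕ, N ≤ n →
      ∀ (δ ε σ : ℝ) (k : ℕ), 0 < δ → δ < 1 → 0 < ε → ε ≤ 1 →
      C * Real.log (2 / δ) * Real.log n ^ (1 / 4 : ℝ) * (k : ℝ) ^ (-(1 / 4) : ℝ) * ε⁻¹ ≤ σ →
      C₁ * Real.log (1 / δ) ^ 2 * Real.log n + 1 ≤ k →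
      k ≤ C₂ * Real.log (1 / δ) ^ (2 * D / (4 + D) : ℝ) * Real.log n ^ (D / (4 + D) : ℝ)
          * (n : ℝ) ^ (4 / (4 + D) : ℝ) →
      ∀ est : Multiset (EuclideanSpace ℝ (Fin D)) → EuclideanSpace ℝ (Fin D),
      IsKnnModeEstimator k est →
      ∃ G : Set (Fin n → EuclideanSpace ℝ (Fin D)), MeasurableSet G ∧
        1 - ENNReal.ofReal δ ≤ sampleMeasure f n G ∧
        ∀ x ∈ G, IsDifferentiallyPrivateAt (privateMode est σ) ε δ (Finset.univ.val.map x) := by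
  obtain ⟨x₀, hpos, c₁, hc₁, c₂, hc₂, hquad⟩ :=
    exists_global_quadratic_bounds hf hsupp husc huni hmodal
  obtain ⟨b, hb⟩ : ∃ b : ℕ, ∀ x, b < ‖x‖ → f x = 0 := by
    obtain ⟨B, hB⟩ := hsupp.isBounded.exists_norm_le
    obtain ⟨b, hb⟩ := exists_nat_ge B
    exact ⟨b, fun x hx => image_eq_zero_of_notMem_tsupport fun hmem =>
      absurd (hB x hmem) (not_le.2 (hb.trans_lt hx))⟩
  have hD' : (1 : ℝ) ≤ D := by exact_mod_cast hD
  set V := unitBallVolume D * f x₀ with hV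
  have hV0 : 0 < V := mul_pos (unitBallVolume_pos D) hpos
  -- `τ₀` separates the two regimes; the main one needs radii with `r ^ 2 ≤ c * τ`, which the choice
  -- of `a` and the upper bound on `k` provide
  set τ₀ : ℝ := min (1 / 20) (c₂ / (10 * f x₀)) with hτ₀
  have hτ₀0 : 0 < τ₀ := by positivity
  set c : ℝ := min (f x₀ / (16 * c₁)) (40 * f x₀ / (16 * c₂)) with hc
  have hc0 : 0 < c := by positivity
  set q : ℝ := max 1 (5 / V) with hq
  have hq1 : 1 ≤ q := le_max_left _ _
  have hq0 : 0 < q := one_pos.trans_le hq1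
  set a : ℝ := min (1 / 4) (24 * D * c / q ^ 2) with ha
  have ha0 : 0 < a := by positivity
  -- the last two terms of `C` cover the main and the trivial regime respectively
  set C : ℝ := 1 + 34560 * D * f x₀ / c₂ + 864 * D * (3 * b + 1) ^ 2 / τ₀ with hC
  have hC0 : 0 < C := by positivity
  have hCA : 34560 * D * f x₀ / c₂ ≤ C ^ 2 := by
    have h1 : 0 ≤ 34560 * D * f x₀ / c₂ := by positivity
    have h2 : 0 ≤ 864 * D * (3 * b + 1) ^ 2 / τ₀ := by positivity
    nlinarith
  have hCB : 864 * D * (3 * b + 1) ^ 2 / τ₀ ≤ C ^ 2 := by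
    have h1 : 0 ≤ 34560 * D * f x₀ / c₂ := by positivity
    have h2 : 0 ≤ 864 * D * (3 * b + 1) ^ 2 / τ₀ := by positivity
    nlinarith
  refine ⟨C, 1, a ^ (2 * D / (4 + D) : ℝ), hC0, one_pos, by positivity,
    3 + 2 * D + (2 * b + 5) + ⌈V⌉₊, fun n hn δ ε σ k hδ hδ1 hε hε1 hσ hk1 hk2 est hest => ?_⟩
  have hn0 : (0 : ℝ) < n := by exact_mod_cast (by omega : 0 < n)
  have hlog : 1 ≤ Real.log n := by
    rw [Real.le_log_iff_exp_le hn0]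
    have : (3 : ℝ) ≤ n := by exact_mod_cast (by omega : 3 ≤ n)
    linarith [Real.exp_one_lt_d9]
  have hl0 : 0 < Real.log (1 / δ) := Real.log_pos (by rw [lt_div_iff₀ hδ]; linarith)
  have hL0 : 0 < Real.log (2 / δ) := Real.log_pos (by rw [lt_div_iff₀ hδ]; linarith)
  have hk2' : 2 ≤ k := by
    have h1 : 0 < Real.log (1 / δ) ^ 2 * Real.log n := by positivity
    have h2 : (1 : ℝ) < k := by linarith
    exact_mod_cast h2
  have hkr : (0 : ℝ) < k := by exact_mod_cast (by omega : 0 < k)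
  have hkpow := pow_le_of_le_rpow ha0.le hl0.le (by linarith) hk2
  have hkn : 2 * k ≤ n := two_mul_le_of_pow_le hD ha0.le (min_le_left _ _) (by linarith)
    (by omega) (by linarith) hkpow
  set L := Real.log (2 / δ) with hL
  set w : ℝ := Real.log n ^ (1 / 4 : ℝ) * (k : ℝ) ^ (-(1 / 4) : ℝ) with hwdef
  have hw0 : 0 < w := by positivity
  have hwk : w ^ 4 * k = Real.log n := by
    rw [hwdef, mul_pow, ← Real.rpow_natCast, ← Real.rpow_natCast, ← Real.rpow_mul (by linarith),
      ← Real.rpow_mul hkr.le]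
    norm_num
    rw [Real.rpow_neg_one]
    field_simp
  have hσε : C * L * w ≤ σ * ε := by
    have h1 : C * L * w * ε⁻¹ ≤ σ := by
      rw [hwdef, ← mul_assoc]
      exact hσ
    rwa [← div_eq_mul_inv, div_le_iff₀ hε] at h1
  have hσ0 : 0 < σ := pos_of_mul_pos_left (lt_of_lt_of_le (by positivity) hσε) hε.le
  have hσε2 : C ^ 2 * (L * w) ^ 2 ≤ (σ * ε) ^ 2 := by
    rw [← mul_pow, ← mul_assoc]
    exact pow_le_pow_left₀ (by positivity) hσε 2
  rcases le_or_gt (24 * D * L * w ^ 2) τ₀ with hτ | hτ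
  · have hcc₁ : 16 * c₁ * c ≤ f x₀ := by
      have := min_le_left (f x₀ / (16 * c₁)) (40 * f x₀ / (16 * c₂))
      rw [le_div_iff₀ (by positivity)] at this
      linarith
    have hcc₂ : 16 * c * c₂ ≤ 40 * f x₀ := by
      have := min_le_right (f x₀ / (16 * c₁)) (40 * f x₀ / (16 * c₂))
      rw [le_div_iff₀ (by positivity)] at this
      linarith
    have hq5 : 5 ≤ q * V := by
      rw [← div_le_iff₀ hV0]
      exact le_max_right _ _
    have haq : a * q ^ 2 ≤ 24 * D * c := by
      rw [← le_div_iff₀ (by positivity)]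
      exact min_le_right _ _
    have hτ2 : 10 * f x₀ * (24 * D * L * w ^ 2) ≤ c₂ := by
      have := hτ.trans (min_le_right _ _)
      rw [le_div_iff₀ (by positivity)] at this
      linarith
    have hnV : V ≤ n := (Nat.le_ceil V).trans (by exact_mod_cast (by omega : ⌈V⌉₊ ≤ n))
    obtain ⟨G, r, r', R, hGm, hG, hr0, hrr', hR, hGx⟩ :=
      hf.exists_event_of_precision_le (n := n) (k := k) hD hb hpos (fun x => (hquad x).1) hc₁
        (fun x => (hquad x).2) hc₂ (by omega) (by omega) (by omega) hnV hlog (by omega) (by omega)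
        hδ hδ1 hw0 hwk hc0 hcc₁ hcc₂ hq1 hq5 ha0.le haq hkpow (hτ.trans (min_le_left _ _)) hτ2
    refine ⟨G, hGm, hG, fun x hx => ?_⟩
    obtain ⟨h1, h2, h3⟩ := hGx x hx
    refine hest.isDifferentiallyPrivateAt hr0 hrr' h1 h2 h3 hδ hδ1 hε hε1 hσ0 (le_trans ?_ hσε2)
    have h4 : 36 * R ^ 2 * L = 34560 * D * f x₀ / c₂ * (L * w) ^ 2 := by
      have : R ^ 2 = 40 * (24 * D * L * w ^ 2) * f x₀ / c₂ := by
        rw [← hR]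
        field_simp
      rw [this]
      ring
    rw [← hL, h4]
    gcongr
  · obtain ⟨G, hGm, hG, hGx⟩ := hf.exists_bounding_event (n := n) hb hk2' (by omega)
    refine ⟨G, hGm, by rw [hG]; exact tsub_le_self, fun x hx => ?_⟩
    obtain ⟨h1, h2, h3⟩ := hGx x hx
    refine hest.isDifferentiallyPrivateAt (by positivity) (by linarith) h1 h2 h3 hδ hδ1 hε hε1 hσ0
      (le_trans ?_ hσε2)
    rw [← hL]
    calc 36 * (3 * b + 1) ^ 2 * L = 864 * D * (3 * b + 1) ^ 2 / τ₀ * (L * (τ₀ / (24 * D))) := by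
          field_simp
          ring
      _ ≤ C ^ 2 * (L * (L * w ^ 2)) := by
          gcongr
          rw [div_le_iff₀ (by positivity)]
          linarith
      _ = C ^ 2 * (L * w) ^ 2 := by ring
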